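/- **Setting.** There are $N\ge 1$ players; player $i$ chooses $x_i\in\Omega_i\subseteq\mathbb R^{n_i}$, and $x=(x_1,\dots,x_N)\in\Omega=\prod_i\Omega_i$. Let $\xi$ be a random variable on a probability space $(\Xi,\mathcal F,\mathbb P)$ with values in a measurable space $S$ (for instance $\mathbb R^d$), let $J_i(x,s)$ be jointly measurable sampled costs, and put $\mathbb J_i(x)=\mathbb E[J_i(x,\xi)]$ and $\mathbb F(x)=(\mathbb E[\nabla_{x_i}J_i(x,\xi)])_{i}$. The shared constraint is $Ax=\sum_iA_ix_i\le b\in\mathbb R^m$, and $\mathcal X=\{x\in\Omega: Ax\le b\}$. A *variational generalized Nash equilibrium* (v-GNE) is a point $x^*\in\mathcal X$ such that $\mathbb J_i(x^*)\le\mathbb J_i(y,x^*_{-i})$ for all $i$ and all $y\in\Omega_i$ with $(y,x^*_{-i})\in\mathcal X$, and $\langle\mathbb F(x^*),x-x^*\rangle\ge0$ for all $x\in\mathcal X$. **Standing assumptions.** (a) Each $\Omega_i$ is nonempty, compact and convex, and some $\hat x\in\Omega$ satisfies $A\hat x<b$ componentwise (Slater). (b) $J_i(x,\xi)$ is integrable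 for $x\in\mathcal X$. For all $x_{-i}$ and $s$, $J_i(\cdot,x_{-i},s)$ is convex and continuously differentiable; for $x\in\Omega$, there is an open neighbourhood of $\Omega_i$ on which, for every $s$, it is Lipschitz with a constant $\ell_i(x_{-i},s)$ such that $\ell_i(x_{-i},\xi)$ is integrable. (c) $\mathbb F$ is $\eta$-strongly monotone and $\ell$-Lipschitz on $\Omega$, with $\eta,\ell>0$. (d) $W=(w_{ij})$ is the symmetric weighted adjacency matrix of a connected undirected graph on the players ($w_{ij}>0$ on edges, $w_{ij}=0$ otherwise); $d_i=\sum_jw_{ij}$ and $d^*=\max_id_i$. (e) $\delta\in(0,1]$, $0<\beta\le\min\{1/(2d^*),\eta/\ell^2\}$ (with $1/0=\infty$), $\tau>1/(2\beta)$, and for all $i$: $0<\alpha_i\le(\max_j\sum_r|[A_i]_{rj}|+\tau)^{-1}$, $0<\nu_i\le(2d_i+\tau)^{-1}$, $0<\sigma_i\le(\max_r\sum_j|[A_i]_{rj}|+2d_i+\tau)^{-1}$. **Algorithm.** Let $b=\sum_ib_i$. The initial point $X_0=(x^0,z^0,\lambda^0)$ may be random and satisfies $x_i^0\in\Omega_i$,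 $z_i^0\in\mathbb R^m$, $\lambda_i^0\in\mathbb R^m_{\ge0}$. For $k\ge0$ and all $i$, $$\tilde x_i^k=\mathrm{proj}_{\Omega_i}\bigl[x_i^k-\alpha_i(\hat F_i^k+A_i^\top\lambda_i^k)\bigr],\qquad \tilde z_i^k=z_i^k-\nu_i\sum_jw_{ij}(\lambda_i^k-\lambda_j^k),$$ $$\tilde\lambda_i^k=\mathrm{proj}_{\mathbb R^m_{\ge0}}\Bigl[\lambda_i^k+\sigma_i\bigl(A_i(2\tilde x_i^k-x_i^k)-b_i\bigr)+\sigma_i\sum_jw_{ij}\bigl(2(\tilde z_i^k-\tilde z_j^k)-(z_i^k-z_j^k)\bigr)-\sigma_i\sum_jw_{ij}(\lambda_i^k-\lambda_j^k)\Bigr],$$ and $(x^{k+1},z^{k+1},\lambda^{k+1})=(1-\delta)(x^k,z^k,\lambda^k)+\delta(\tilde x^k,\tilde z^k,\tilde\lambda^k)$. Here $\hat F_i^k=\frac1{N_k}\sum_{t=1}^{N_k}\nabla_{x_i}J_i(x^k,\xi_i^{k,t})$. For each $i,k$ the samples $\xi_i^{k,1},\dots,\xi_i^{k,N_k}$ are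 i.i.d. with the law of $\xi$, and the samples of iteration $k$ are independent of $\mathcal F_k$, the $\sigma$-algebra generated by $X_0$ and the samples of the iterations before $k$. Put $\varepsilon^k=\hat F^k-\mathbb F(x^k)$. **Theorem.** Assume that there are $c,k_0,a>0$ with $N_k\ge c(k+k_0)^{a+1}$ for all $k\ge0$, and that there are constants $C,\varsigma$ such that, for $q=1$ or for $q=2$, $\mathbb E[\|\varepsilon^k\|^q\mid\mathcal F_k]\le C\varsigma^2/N_k$ almost surely for all $k\ge0$. Then there is a v-GNE $x^*$ such that almost surely $x^k\to x^*$. Moreover, almost surely $z^k$ converges, and all $\lambda_i^k$ converge to one common (possibly random) $\lambda^*$ such that $(x^*,\lambda^*)$ satisfies the KKT conditions $0\in\mathbb F_i(x^*)+N_{\Omega_i}(x_i^*)+A_i^\top\lambda^*$ for all $i$ and $0\in-(Ax^*-b)+N_{\mathbb R^m_{\ge0}}(\lambda^*)$. -/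

import Mathlib

open MeasureTheory ProbabilityTheory Filter Topology

noncomputable section

namespace SGNEP

/-- `ℝ^d` with the Euclidean norm. -/
abbrev Vec (d : ℕ) : Type := EuclideanSpace ℝ (Fin d)

/-- Collective strategies `x = col(x_1, …, x_N)`, `x_i ∈ ℝ^{n_i}`, with the Euclidean norm. -/
abbrev Strat {N : ℕ} (n : Fin N → ℕ) : Type := PiLp 2 (fun i => Vec (n i))

/-- The collective strategy `(y, x_{-i})`: player `i`'s block of `x` is replaced by `y`. -/
def deviate {N : ℕ} {n : Fin N → ℕ} (x : Strat n) (i : Fin N) (y : Vec (n i)) : Strat n :=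
  WithLp.toLp 2 (Function.update x.ofLp i y)

/-- The product `M v` of a matrix and a Euclidean vector. -/
def mulV {p q : ℕ} (M : Matrix (Fin p) (Fin q) ℝ) (v : Vec q) : Vec p :=
  WithLp.toLp 2 (M.mulVec v.ofLp)

/-- The nonnegative orthant of `ℝ^m`. -/
def orthant (m : ℕ) : Set (Vec m) := {v | ∀ j, 0 ≤ v j}

/-- The normal cone of `C` at `x` (empty if `x ∉ C`). -/
def normalCone {E : Type*} [NormedAddCommGroup E] [InnerProductSpace ℝ E] (C : Set E) (x : E) :
    Set E :=
  {v | x ∈ C ∧ ∀ z ∈ C, inner ℝ v (z - x) ≤ 0}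

/-- The projection `argmin_{v ∈ C} ‖v - u‖` onto `C`; the minimizer exists and is unique if `C` is
nonempty, closed and convex. -/
def proj {E : Type*} [NormedAddCommGroup E] (C : Set E) (u : E) : E :=
  Classical.epsilon (fun v => v ∈ C ∧ ∀ w ∈ C, ‖v - u‖ ≤ ‖w - u‖)

/-- The data of a stochastic game with `N` players, action spaces `ℝ^{n_i}`, `m` shared affine
constraints and uncertainty with values in `S`. -/
structure Game (N : ℕ) (n : Fin N → ℕ) (m : ℕ) (S : Type*) where
  /-- local decision sets `Ω_i` -/
  dom : (i : Fin N) → Set (Vec (n i))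
  /-- blocks `A_i` of the shared constraint `∑ A_i x_i ≤ b` -/
  A : (i : Fin N) → Matrix (Fin m) (Fin (n i)) ℝ
  /-- right-hand side `b` of the shared constraint -/
  b : Vec m
  /-- sampled cost functions `J_i(x, ξ)` -/
  J : Fin N → Strat n → S → ℝ

section game

variable {N : ℕ} {n : Fin N → ℕ} {m : ℕ} {S : Type*} (g : Game N n m S)

/-- `Ω = ∏ Ω_i`. -/
def Game.domain : Set (Strat n) := {x | ∀ i, x i ∈ g.dom i}

/-- `A x = ∑ A_i x_i`. -/
def Game.Ax (x : Strat n) : Vec m := ∑ i, mulV (g.A i) (x i)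

/-- The collective feasible set `{x ∈ Ω | A x ≤ b}`. -/
def Game.feasible : Set (Strat n) := {x | x ∈ g.domain ∧ ∀ j, g.Ax x j ≤ g.b j}

/-- The feasible set of player `i`: `{y ∈ Ω_i | A_i y ≤ b - ∑_{j ≠ i} A_j x_j}`. -/
def Game.feasibleAt (i : Fin N) (x : Strat n) : Set (Vec (n i)) :=
  {y | y ∈ g.dom i ∧
    ∀ r, mulV (g.A i) y r ≤ (g.b - ∑ j ∈ Finset.univ.erase i, mulV (g.A j) (x j)) r}

/-- The partial gradient `∇_{x_i} J_i(x_i, x_{-i}, s)`. -/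
def Game.gradJ (i : Fin N) (x : Strat n) (s : S) : Vec (n i) :=
  gradient (fun y => g.J i (deviate x i y) s) (x i)

variable {Ξ : Type*} [MeasurableSpace Ξ] (P : Measure Ξ) (ξ : Ξ → S)

/-- The expected cost `𝕁_i(x) = E[J_i(x, ξ)]`. -/
def Game.cost (i : Fin N) (x : Strat n) : ℝ := ∫ ω, g.J i x (ξ ω) ∂P

/-- The pseudo-gradient `𝔽(x) = col(E[∇_{x_i} J_i(x, ξ)])`. -/
def Game.F (x : Strat n) : Strat n := WithLp.toLp 2 (fun i => ∫ ω, g.gradJ i x (ξ ω) ∂P)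

/-- Stochastic generalized Nash equilibria. -/
def Game.IsGNE (x : Strat n) : Prop :=
  x ∈ g.feasible ∧ ∀ i, ∀ y ∈ g.feasibleAt i x, g.cost P ξ i x ≤ g.cost P ξ i (deviate x i y)

/-- Solutions of the stochastic variational inequality of `𝔽` over the feasible set. -/
def Game.IsSVISolution (x : Strat n) : Prop :=
  x ∈ g.feasible ∧ ∀ y ∈ g.feasible, 0 ≤ inner ℝ (g.F P ξ x) (y - x)

/-- Variational generalized Nash equilibria: equilibria that solve the variational inequality. -/
def Game.IsVGNE (x : Strat n) : Prop := g.IsGNE P ξ x ∧ g.IsSVISolution P ξ x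

/-- The KKT system of the variational inequality with one multiplier `l` for all players:
`0 ∈ 𝔽_i(x) + N_{Ω_i}(x_i) + A_iᵀ l` for all `i`, and `0 ∈ -(A x - b) + N_{ℝ^m_{≥0}}(l)`. -/
def Game.IsKKT (x : Strat n) (l : Vec m) : Prop :=
  (∀ i, -(g.F P ξ x i + mulV (g.A i).transpose l) ∈ normalCone (g.dom i) (x i)) ∧
    g.Ax x - g.b ∈ normalCone (orthant m) l

/-- Standing assumptions on the local sets and on the constraints. -/
structure Game.ConstraintAssumptions : Prop where
  nonempty : ∀ i, (g.dom i).Nonempty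
  compact : ∀ i, IsCompact (g.dom i)
  convex : ∀ i, Convex ℝ (g.dom i)
  slater : ∃ x ∈ g.domain, ∀ j, g.Ax x j < g.b j

/-- Standing assumptions on the cost functions. Lipschitz continuity is only asked near the compact
set `Ω_i`, since a globally Lipschitz cost cannot have a strongly monotone gradient. -/
structure Game.CostAssumptions [MeasurableSpace S] : Prop where
  measurable : ∀ i, Measurable (fun p : Strat n × S => g.J i p.1 p.2)
  integrable : ∀ i, ∀ x ∈ g.feasible, Integrable (fun ω => g.J i x (ξ ω)) P
  convex : ∀ i x s, ConvexOn ℝ Set.univ (fun y => g.J i (deviate x i y) s)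
  contDiff : ∀ i x s, ContDiff ℝ 1 (fun y => g.J i (deviate x i y) s)
  lipschitz : ∀ i, ∀ x ∈ g.domain, ∃ (K : S → NNReal) (U : Set (Vec (n i))),
    Integrable (fun ω => (K (ξ ω) : ℝ)) P ∧ IsOpen U ∧ g.dom i ⊆ U ∧
      ∀ s, LipschitzOnWith (K s) (fun y => g.J i (deviate x i y) s) U

/-- `𝔽` is `η`-strongly monotone and `ℓ`-Lipschitz on `Ω`. -/
structure Game.PseudoGradientAssumptions (η ℓ : ℝ) : Prop where
  eta_pos : 0 < η
  ell_pos : 0 < ℓ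
  stronglyMonotone : ∀ x ∈ g.domain, ∀ y ∈ g.domain,
    η * ‖x - y‖ ^ 2 ≤ inner ℝ (g.F P ξ x - g.F P ξ y) (x - y)
  lipschitz : ∀ x ∈ g.domain, ∀ y ∈ g.domain, ‖g.F P ξ x - g.F P ξ y‖ ≤ ℓ * ‖x - y‖

end game

/-- `W` is the weighted adjacency matrix of the undirected connected graph `G` on the players. -/
structure DualGraph {N : ℕ} (G : SimpleGraph (Fin N)) (W : Matrix (Fin N) (Fin N) ℝ) : Prop where
  connected : G.Connected
  symm : W.IsSymm
  pos : ∀ i j, G.Adj i j → 0 < W i j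
  zero : ∀ i j, ¬ G.Adj i j → W i j = 0

/-- The parameters of the algorithm. -/
structure Params (N m : ℕ) where
  /-- step sizes of the primal variables -/
  α : Fin N → ℝ
  /-- step sizes of the auxiliary variables -/
  ν : Fin N → ℝ
  /-- step sizes of the dual variables -/
  σ : Fin N → ℝ
  /-- damping -/
  δ : ℝ
  /-- weights of the dual graph -/
  W : Matrix (Fin N) (Fin N) ℝ
  /-- local parts `b_i` of the right-hand side `b` -/
  b : Fin N → Vec m

/-- The weighted degree `d_i = ∑_j w_{ij}`. -/
def Params.deg {N m : ℕ} (p : Params N m) (i : Fin N) : ℝ := ∑ j, p.W i j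

/-- `β ≤ min {1 / (2 d^*), η / ℓ²}`, `τ > 1 / (2 β)`, `δ ∈ (0, 1]`, and the bounds on the step
sizes, written without divisions (so `1 / (2 d^*)` is `∞` if `d^* = 0`). -/
structure StepAssumptions {N m : ℕ} {n : Fin N → ℕ} {S : Type*} (g : Game N n m S)
    (p : Params N m) (η ℓ β τ : ℝ) : Prop where
  delta_pos : 0 < p.δ
  delta_le : p.δ ≤ 1
  beta_pos : 0 < β
  beta_deg : ∀ i, 2 * p.deg i * β ≤ 1
  beta_F : β * ℓ ^ 2 ≤ η
  tau_pos : 0 < τ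
  tau : 1 < 2 * β * τ
  alpha_pos : ∀ i, 0 < p.α i
  alpha : ∀ i, ∀ j : Fin (n i), p.α i * ((∑ r : Fin m, |g.A i r j|) + τ) ≤ 1
  nu_pos : ∀ i, 0 < p.ν i
  nu : ∀ i, p.ν i * (2 * p.deg i + τ) ≤ 1
  sigma_pos : ∀ i, 0 < p.σ i
  sigma : ∀ i, ∀ r : Fin m, p.σ i * ((∑ j : Fin (n i), |g.A i r j|) + 2 * p.deg i + τ) ≤ 1

/-- The variables `(x, z, λ)` of the algorithm. -/
abbrev State {N : ℕ} (n : Fin N → ℕ) (m : ℕ) : Type :=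
  Strat n × (Fin N → Vec m) × (Fin N → Vec m)

section algorithm

variable {N : ℕ} {n : Fin N → ℕ} {m : ℕ} {S : Type*} (g : Game N n m S) (p : Params N m)

/-- The forward-backward step `x̃`, given an estimate `Fhat` of `𝔽(x)`. -/
def xTilde (Fhat : Strat n) (w : State n m) : Strat n :=
  WithLp.toLp 2 (fun i =>
    proj (g.dom i) (w.1 i - p.α i • (Fhat i + mulV (g.A i).transpose (w.2.2 i))))

/-- The update `z̃`. -/
def zTilde (w : State n m) (i : Fin N) : Vec m :=
  w.2.1 i - p.ν i • ∑ j, p.W i j • (w.2.2 i - w.2.2 j)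

/-- The update `λ̃`. -/
def lamTilde (Fhat : Strat n) (w : State n m) (i : Fin N) : Vec m :=
  proj (orthant m) (w.2.2 i
    + p.σ i • (mulV (g.A i) ((2 : ℝ) • xTilde g p Fhat w i - w.1 i) - p.b i)
    + p.σ i • ∑ j, p.W i j •
        ((2 : ℝ) • (zTilde p w i - zTilde p w j) - (w.2.1 i - w.2.1 j))
    - p.σ i • ∑ j, p.W i j • (w.2.2 i - w.2.2 j))

/-- One damped iteration of the algorithm. -/
def step (Fhat : Strat n) (w : State n m) : State n m :=
  ((1 - p.δ) • w.1 + p.δ • xTilde g p Fhat w,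
    (fun i => (1 - p.δ) • w.2.1 i + p.δ • zTilde p w i),
    (fun i => (1 - p.δ) • w.2.2 i + p.δ • lamTilde g p Fhat w i))

/-- The sample average `F̂(x)` over the `B` samples `samp i 0, …, samp i (B - 1)` of each player. -/
def saa (B : ℕ) (samp : Fin N → ℕ → S) (x : Strat n) : Strat n :=
  WithLp.toLp 2 (fun i => (B : ℝ)⁻¹ • ∑ t ∈ Finset.range B, g.gradJ i x (samp i t))

variable {Ξ : Type*}

/-- The random iterates, for initial point `X0`, batch sizes `B k`, and samples `samp k i t`
(iteration `k`, player `i`, number `t < B k`). -/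
def iter (B : ℕ → ℕ) (samp : ℕ → Fin N → ℕ → Ξ → S) (X0 : Ξ → State n m) :
    ℕ → Ξ → State n m
  | 0, ω => X0 ω
  | k + 1, ω =>
    step g p (saa g (B k) (fun i t => samp k i t ω) (iter B samp X0 k ω).1) (iter B samp X0 k ω)

/-- The stochastic error `ε^k = F̂(x^k, ξ^k) - 𝔽(x^k)`. -/
def err [MeasurableSpace Ξ] (P : Measure Ξ) (ξ : Ξ → S) (B : ℕ → ℕ)
    (samp : ℕ → Fin N → ℕ → Ξ → S) (X0 : Ξ → State n m) (k : ℕ) (ω : Ξ) : Strat n :=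
  saa g (B k) (fun i t => samp k i t ω) (iter g p B samp X0 k ω).1
    - g.F P ξ (iter g p B samp X0 k ω).1

end algorithm

section sampling

variable {N : ℕ} {n : Fin N → ℕ} {m : ℕ} {S Ξ : Type*} [MeasurableSpace S]

/-- The σ-algebra generated by the samples drawn at iteration `k`. -/
abbrev batchσ (B : ℕ → ℕ) (samp : ℕ → Fin N → ℕ → Ξ → S) (k : ℕ) : MeasurableSpace Ξ :=
  ⨆ (i : Fin N) (t : Fin (B k)), MeasurableSpace.comap (samp k i t) inferInstance

/-- `F_k`, the information at the beginning of iteration `k`: generated by the initial point and by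
the samples drawn in the iterations before `k`. -/
abbrev pastσ (B : ℕ → ℕ) (samp : ℕ → Fin N → ℕ → Ξ → S) (X0 : Ξ → State n m) (k : ℕ) :
    MeasurableSpace Ξ :=
  MeasurableSpace.comap X0 inferInstance ⊔ ⨆ j : Fin k, batchσ B samp j

/-- The samples of each player are i.i.d. with the law of `ξ`, fresh at each iteration, and
independent of the initial point. The samples of different players may coincide. -/
structure IsSampling [MeasurableSpace Ξ] (P : Measure Ξ) (ξ : Ξ → S) (B : ℕ → ℕ)
    (samp : ℕ → Fin N → ℕ → Ξ → S) (X0 : Ξ → State n m) : Prop where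
  measurable : ∀ k i t, Measurable (samp k i t)
  measurable_init : Measurable X0
  law : ∀ k i t, IdentDistrib (samp k i t) ξ P P
  indep_batch : ∀ k i, iIndepFun (fun t : Fin (B k) => samp k i t) P
  indep_past : ∀ k, Indep (batchσ B samp k) (pastσ B samp X0 k) P

end sampling

end SGNEP

end

/-! The v-GNE, a common multiplier and an auxiliary `z` form a zero (`IsZero`) of an extended
monotone inclusion, and one undamped iteration is a forward-backward step for it in the metric
`quad`. The step-size bounds say that the matrix of this metric exceeds `τ` times the identity by
diagonal dominance (`le_preQuad`). The forward terms, the pseudo-gradient and the Laplacian of the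
multipliers, are both `β`-cocoercive. Hence (`quad_tilde_sub_le`) a step lowers the squared distance
to any zero by a fixed multiple of the squared residual, up to `2⟨ε, x̃ - x*⟩`.

The noisy `x̃` depends on `ε`. Replacing it by the noise-free `x̃`, which is known before the
samples are drawn, costs a multiple of `‖ε‖²` (`inner_xTilde_sub_le`). The squares are almost surely
summable because the inverse batch sizes are. The remaining series `∑ ⟨ε, x̃ - x*⟩` converges
absolutely if `q = 1`, since `Ω` is bounded. If `q = 2`, it is an `L²`-bounded martingale
(`ae_exists_tendsto_sum_inner_err`).

On a path where both series converge, the distance to each zero converges and the residual tends to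
zero, so Opial's argument (`tendsto_of_fejer`) yields one limit, itself a zero. By strong
monotonicity all zeros have the same `x`-part (`IsZero.fst_eq`). Thus a single null set serves every
zero, and the limit of `x` is not random.

A zero exists: the variational inequality has a solution by a contraction argument, Slater's
condition gives a multiplier, and the Laplacian reaches every family of blocks with sum zero
(`exists_isZero`). -/

noncomputable section
namespace SGNEP

/-! ### Projections onto closed convex sets and the orthant. -/

section projection

variable {E : Type*} [NormedAddCommGroup E] [InnerProductSpace ℝ E] {C : Set E}

/-- The norm minimizer exists, so the choice in `proj` really picks it; the variational form is all
that is used later. -/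
theorem proj_spec (hne : C.Nonempty) (hC : IsComplete C) (hcv : Convex ℝ C) (u : E) :
    proj C u ∈ C ∧ ∀ y ∈ C, inner ℝ (u - proj C u) (y - proj C u) ≤ 0 := by
  have hex : ∃ v, v ∈ C ∧ ∀ w ∈ C, ‖v - u‖ ≤ ‖w - u‖ := by
    obtain ⟨v, hv, h⟩ := exists_norm_eq_iInf_of_complete_convex hne hC hcv u
    refine ⟨v, hv, fun w hw => ?_⟩
    rw [norm_sub_rev v u, norm_sub_rev w u, h]
    exact ciInf_le ⟨0, Set.forall_mem_range.2 fun _ => norm_nonneg _⟩ (⟨w, hw⟩ : C)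
  have hs : proj C u ∈ C ∧ ∀ w ∈ C, ‖proj C u - u‖ ≤ ‖w - u‖ := Classical.epsilon_spec hex
  refine ⟨hs.1, (norm_eq_iInf_iff_real_inner_le_zero hcv hs.1).1 (le_antisymm ?_ ?_)⟩
  · have : Nonempty C := ⟨⟨_, hs.1⟩⟩
    refine le_ciInf fun w => ?_
    rw [norm_sub_rev u, norm_sub_rev u]
    exact hs.2 w w.2
  · exact ciInf_le ⟨0, Set.forall_mem_range.2 fun _ => norm_nonneg _⟩ (⟨_, hs.1⟩ : C)

theorem norm_proj_sub_proj_le (hne : C.Nonempty) (hC : IsComplete C) (hcv : Convex ℝ C)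
    (u v : E) : ‖proj C u - proj C v‖ ≤ ‖u - v‖ := by
  obtain ⟨hu, hu'⟩ := proj_spec hne hC hcv u
  obtain ⟨hv, hv'⟩ := proj_spec hne hC hcv v
  have h1 := hu' _ hv
  have h2 := hv' _ hu
  have h3 : ‖proj C u - proj C v‖ ^ 2 ≤ inner ℝ (u - v) (proj C u - proj C v) := by
    rw [← real_inner_self_eq_norm_sq]
    simp only [inner_sub_left, inner_sub_right] at *
    linarith
  have h4 := real_inner_le_norm (u - v) (proj C u - proj C v)
  by_contra! h
  nlinarith [norm_nonneg (u - v)]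

theorem continuous_proj (hne : C.Nonempty) (hC : IsComplete C) (hcv : Convex ℝ C) :
    Continuous (proj C) :=
  (LipschitzWith.of_dist_le_mul (K := 1) fun u v => by
    simpa [dist_eq_norm] using norm_proj_sub_proj_le hne hC hcv u v).continuous

theorem orthant_nonempty (m : ℕ) : (orthant m).Nonempty := ⟨0, fun _ => le_rfl⟩

theorem orthant_isComplete (m : ℕ) : IsComplete (orthant m) := by
  have : orthant m = ⋂ j, {v : Vec m | 0 ≤ v j} := by ext v; simp [orthant]
  rw [this]
  exact (isClosed_iInter fun j => isClosed_le continuous_const (by fun_prop)).isComplete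

theorem orthant_convex (m : ℕ) : Convex ℝ (orthant m) := by
  intro u hu v hv a b ha hb _ j
  have h1 := mul_nonneg ha (hu j)
  have h2 := mul_nonneg hb (hv j)
  simpa using add_nonneg h1 h2

end projection

/-! ### The one-step estimate for an abstract preconditioned forward-backward step. -/

section abstract_inequality

variable {X Y : Type*} [NormedAddCommGroup X] [InnerProductSpace ℝ X]
  [NormedAddCommGroup Y] [InnerProductSpace ℝ Y]

theorem real_inner_le_young {β : ℝ} (hβ : 0 < β) (d v : X) :
    inner ℝ d v ≤ β * ‖d‖ ^ 2 + 1 / (4 * β) * ‖v‖ ^ 2 := by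
  refine (real_inner_le_norm d v).trans ?_
  have : β * ‖d‖ ^ 2 + 1 / (4 * β) * ‖v‖ ^ 2 - ‖d‖ * ‖v‖
      = (2 * β * ‖d‖ - ‖v‖) ^ 2 / (4 * β) := by field_simp; ring
  have h : 0 ≤ (2 * β * ‖d‖ - ‖v‖) ^ 2 / (4 * β) := by positivity
  linarith

/-- The quadratic form of the preconditioning matrix
`[[Sa, 0, -Kᵀ], [0, Sn, -L], [-K, -L, Ss]]`. -/
def preQuad (Sa : X →ₗ[ℝ] X) (Sn Ss : Y →ₗ[ℝ] Y) (K : X →ₗ[ℝ] Y) (L : Y →ₗ[ℝ] Y)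
    (x : X) (z l : Y) : ℝ :=
  inner ℝ (Sa x) x + inner ℝ (Sn z) z + inner ℝ (Ss l) l - 2 * inner ℝ (K x) l
    - 2 * inner ℝ (L z) l

variable (Sa : X →ₗ[ℝ] X) (Sn Ss : Y →ₗ[ℝ] Y) (K : X →ₗ[ℝ] Y) (L : Y →ₗ[ℝ] Y)

theorem preQuad_convexCombo (t : ℝ) (x x' : X) (z z' l l' : Y) :
    preQuad Sa Sn Ss K L ((1 - t) • x + t • x') ((1 - t) • z + t • z') ((1 - t) • l + t • l')
      = (1 - t) * preQuad Sa Sn Ss K L x z l + t * preQuad Sa Sn Ss K L x' z' l'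
        - t * (1 - t) * preQuad Sa Sn Ss K L (x - x') (z - z') (l - l') := by
  simp only [preQuad, map_add, map_sub, map_smul, inner_add_left, inner_add_right, inner_sub_left,
    inner_sub_right, real_inner_smul_left, real_inner_smul_right]
  ring

/-- `hx`, `hz`, `hl` are the resolvent inclusions of the step, and `hxs`, `hzs`, `hls` say that the
starred point is a zero. Adding them cancels the skew coupling through `K` and `L`. What is left of
the forward terms is paid for by cocoercivity and Young's inequality, at the price of the fraction
`1 / (2βτ)` of the residual. -/
theorem preQuad_forwardBackward_le (hSa : Sa.IsSymmetric) (hSn : Sn.IsSymmetric)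
    (hSs : Ss.IsSymmetric) (hL : L.IsSymmetric) {β τ : ℝ} (hβ : 0 < β) (hτ : 0 < τ)
    (hpos : ∀ x z l, τ * (‖x‖ ^ 2 + ‖z‖ ^ 2 + ‖l‖ ^ 2) ≤ preQuad Sa Sn Ss K L x z l)
    (x xt xs f fs ε : X) (z zt zs l lt ls b : Y)
    (hx : inner ℝ (Sa (x - xt)) (xs - xt) ≤ inner ℝ (f + ε) (xs - xt) + inner ℝ (K (xs - xt)) l)
    (hz : Sn (z - zt) = L l)
    (hl : inner ℝ (Ss (l - lt) + K ((2 : ℝ) • xt - x) - b + L ((2 : ℝ) • zt - z) - L l) (ls - lt)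
      ≤ 0)
    (hxs : 0 ≤ inner ℝ fs (xt - xs) + inner ℝ (K (xt - xs)) ls)
    (hzs : L ls = 0)
    (hls : inner ℝ (K xs - b + L zs) (lt - ls) ≤ 0)
    (hf : β * ‖f - fs‖ ^ 2 ≤ inner ℝ (f - fs) (x - xs))
    (hLl : β * ‖L (l - ls)‖ ^ 2 ≤ inner ℝ (L (l - ls)) (l - ls)) :
    preQuad Sa Sn Ss K L (xt - xs) (zt - zs) (lt - ls)
      ≤ preQuad Sa Sn Ss K L (x - xs) (z - zs) (l - ls)
        - (1 - 1 / (2 * β * τ)) * preQuad Sa Sn Ss K L (x - xt) (z - zt) (l - lt)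
        - 2 * inner ℝ ε (xt - xs) := by
  have y1 := real_inner_le_young hβ (f - fs) (x - xt)
  have y2 := real_inner_le_young hβ (L (l - ls)) (l - lt)
  have hp : 1 / (4 * β) * (‖x - xt‖ ^ 2 + ‖l - lt‖ ^ 2)
      ≤ 1 / (4 * β * τ) * preQuad Sa Sn Ss K L (x - xt) (z - zt) (l - lt) := by
    have h := mul_le_mul_of_nonneg_left (hpos (x - xt) (z - zt) (l - lt))
      (by positivity : 0 ≤ 1 / (4 * β * τ))
    refine le_trans ?_ h
    have : 1 / (4 * β * τ) * (τ * (‖x - xt‖ ^ 2 + ‖z - zt‖ ^ 2 + ‖l - lt‖ ^ 2))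
        = 1 / (4 * β) * (‖x - xt‖ ^ 2 + ‖l - lt‖ ^ 2) + 1 / (4 * β) * ‖z - zt‖ ^ 2 := by
      field_simp; ring
    rw [this]
    have : 0 ≤ 1 / (4 * β) * ‖z - zt‖ ^ 2 := by positivity
    linarith
  have hc : 1 / (2 * β * τ) = 2 * (1 / (4 * β * τ)) := by field_simp; ring
  rw [hc]
  set r := 1 / (4 * β * τ) with hr
  set s := 1 / (4 * β) with hs
  set q := preQuad Sa Sn Ss K L (x - xt) (z - zt) (l - lt) with hq
  set Nf := ‖f - fs‖ ^ 2
  set Nl := ‖L (l - ls)‖ ^ 2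
  have hz' : inner ℝ (Sn (z - zt)) (zs - zt) = inner ℝ (L l) (zs - zt) := by rw [hz]
  -- This is the inequality before Young: the terms `-β * Nf` and `-β * Nl` cancel the squares
  -- produced by `y1` and `y2`. It is linear in the inner products once everything is expanded and
  -- symmetry is supplied.
  suffices h : preQuad Sa Sn Ss K L (xt - xs) (zt - zs) (lt - ls)
      ≤ preQuad Sa Sn Ss K L (x - xs) (z - zs) (l - ls) - q
        + 2 * (inner ℝ (f - fs) (x - xt) - β * Nf + inner ℝ (L (l - ls)) (l - lt) - β * Nl)
        - 2 * inner ℝ ε (xt - xs) by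
    linarith
  have sa : ∀ u v, inner ℝ (Sa u) v = inner ℝ (Sa v) u := fun u v => by
    rw [hSa u v, real_inner_comm]
  have sn : ∀ u v, inner ℝ (Sn u) v = inner ℝ (Sn v) u := fun u v => by
    rw [hSn u v, real_inner_comm]
  have ss : ∀ u v, inner ℝ (Ss u) v = inner ℝ (Ss v) u := fun u v => by
    rw [hSs u v, real_inner_comm]
  have sl : ∀ u v, inner ℝ (L u) v = inner ℝ (L v) u := fun u v => by
    rw [hL u v, real_inner_comm]
  have e1 : inner ℝ (L ls) zs = 0 := by rw [hzs, inner_zero_left]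
  have e2 : inner ℝ (L ls) zt = 0 := by rw [hzs, inner_zero_left]
  have e3 : inner ℝ (L ls) z = 0 := by rw [hzs, inner_zero_left]
  have e4 : inner ℝ (L ls) l = 0 := by rw [hzs, inner_zero_left]
  have e5 : inner ℝ (L ls) lt = 0 := by rw [hzs, inner_zero_left]
  have e6 : inner ℝ (L ls) ls = 0 := by rw [hzs, inner_zero_left]
  rw [hq]
  simp only [preQuad, map_sub, map_smul, inner_add_left, inner_sub_left, inner_sub_right,
    real_inner_smul_left] at *
  linarith [sa x xt, sa x xs, sa xt xs, sn z zt, sn z zs, sn zt zs, ss l lt, ss l ls, ss lt ls,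
    sl z l, sl z lt, sl z ls, sl zt l, sl zt lt, sl zt ls, sl zs l, sl zs lt, sl zs ls,
    sl l lt, sl l ls, sl lt ls]

end abstract_inequality

/-! ### Perturbed monotone sequences and Opial's argument. -/

section sequences

/-- Subtracting the partial sums of `e` makes `V` antitone and bounded below. Only convergence of
the signed series is needed, which is what a martingale provides. -/
theorem tendsto_of_perturbed_decrease {V a e : ℕ → ℝ} {s : ℝ} (hV : ∀ k, 0 ≤ V k)
    (ha : ∀ k, 0 ≤ a k) (h : ∀ k, V (k + 1) ≤ V k - a k + e k)
    (he : Tendsto (fun n => ∑ k ∈ Finset.range n, e k) atTop (𝓝 s)) :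
    (∃ v, Tendsto V atTop (𝓝 v)) ∧ Tendsto a atTop (𝓝 0) := by
  set U : ℕ → ℝ := fun n => V n - ∑ k ∈ Finset.range n, e k with hU
  have hUs : ∀ n, U (n + 1) ≤ U n - a n := fun n => by
    simp only [hU, Finset.sum_range_succ]
    linarith [h n]
  have hanti : Antitone U := antitone_nat_of_succ_le fun n => by linarith [hUs n, ha n]
  obtain ⟨M, hM⟩ := he.bddAbove_range
  have hbd : BddBelow (Set.range U) := ⟨-M, by
    rintro _ ⟨n, rfl⟩
    have := hM ⟨n, rfl⟩
    simp only [hU]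
    linarith [hV n]⟩
  have hUt := tendsto_atTop_ciInf hanti hbd
  constructor
  · refine ⟨_, (hUt.add he).congr fun n => ?_⟩
    simp [hU]
  · have h1 := hUt.sub ((tendsto_add_atTop_iff_nat 1).2 hUt)
    rw [sub_self] at h1
    exact squeeze_zero ha (fun n => by linarith [hUs n]) h1

/-- Bounded sequences have a cluster point `y`, which lies in `Z`. The limit of `Q (w k - y)` exists
and vanishes along a subsequence, so it is zero. -/
theorem tendsto_of_fejer {E : Type*} [NormedAddCommGroup E] [ProperSpace E] {Q : E → ℝ}
    (hQ : Continuous Q) (hQ0 : Q 0 = 0) {c : ℝ} (hc : 0 < c) (hQc : ∀ u, c * ‖u‖ ^ 2 ≤ Q u)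
    {Z : Set E} (hZ : Z.Nonempty) {w : ℕ → E}
    (hV : ∀ z ∈ Z, ∃ v, Tendsto (fun k => Q (w k - z)) atTop (𝓝 v))
    (hcl : ∀ (φ : ℕ → ℕ) (y : E), StrictMono φ → Tendsto (w ∘ φ) atTop (𝓝 y) → y ∈ Z) :
    ∃ z ∈ Z, Tendsto w atTop (𝓝 z) := by
  obtain ⟨z₀, hz₀⟩ := hZ
  obtain ⟨v, hv⟩ := hV z₀ hz₀
  obtain ⟨M, hM⟩ := hv.bddAbove_range
  -- The radius comes from `2t ≤ t² + 1`, which avoids a square root.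
  have hbd : ∀ k, w k ∈ Metric.closedBall z₀ (M / c + 1) := fun k => by
    rw [mem_closedBall_iff_norm]
    have h1 : c * ‖w k - z₀‖ ^ 2 ≤ M := (hQc _).trans (hM ⟨k, rfl⟩)
    have h2 : ‖w k - z₀‖ ^ 2 ≤ M / c := by rw [le_div_iff₀ hc]; linarith
    nlinarith [sq_nonneg (‖w k - z₀‖ - 1)]
  obtain ⟨y, -, φ, hφ, hy⟩ := (isCompact_closedBall z₀ (M / c + 1)).tendsto_subseq hbd
  have hyZ := hcl φ y hφ hy
  obtain ⟨v', hv'⟩ := hV y hyZ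
  have h0 : Tendsto (fun k => Q (w (φ k) - y)) atTop (𝓝 0) := by
    have h1 : Tendsto (fun k => w (φ k) - y) atTop (𝓝 0) := by
      simpa using hy.sub_const y
    simpa [hQ0, Function.comp_def] using (hQ.tendsto 0).comp h1
  have hv0 : v' = 0 := tendsto_nhds_unique (hv'.comp hφ.tendsto_atTop) h0
  subst hv0
  refine ⟨y, hyZ, ?_⟩
  rw [tendsto_iff_norm_sub_tendsto_zero]
  have h2 : Tendsto (fun k => ‖w k - y‖ ^ 2) atTop (𝓝 0) := by
    have h3 := hv'.div_const c
    rw [zero_div] at h3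
    refine squeeze_zero (fun k => by positivity) (fun k => ?_) h3
    rw [le_div_iff₀ hc]
    linarith [hQc (w k - y)]
  have h4 := h2.sqrt
  simpa using h4

end sequences

/-! ### Block operators and the weighted graph Laplacian. -/

section blocks

variable {N : ℕ} {n : Fin N → ℕ} {m : ℕ}

theorem mulV_add {p q : ℕ} (M : Matrix (Fin p) (Fin q) ℝ) (u v : Vec q) :
    mulV M (u + v) = mulV M u + mulV M v := by
  simp [mulV, Matrix.mulVec_add]

theorem mulV_smul {p q : ℕ} (M : Matrix (Fin p) (Fin q) ℝ) (a : ℝ) (v : Vec q) :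
    mulV M (a • v) = a • mulV M v := by
  simp [mulV, Matrix.mulVec_smul]

theorem mulV_sub {p q : ℕ} (M : Matrix (Fin p) (Fin q) ℝ) (u v : Vec q) :
    mulV M (u - v) = mulV M u - mulV M v := by
  simp [mulV, Matrix.mulVec_sub]

theorem mulV_apply {p q : ℕ} (M : Matrix (Fin p) (Fin q) ℝ) (v : Vec q) (r : Fin p) :
    mulV M v r = ∑ j, M r j * v j := rfl

theorem continuous_mulV {p q : ℕ} (M : Matrix (Fin p) (Fin q) ℝ) : Continuous (mulV M) := by
  unfold mulV
  fun_prop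

theorem inner_vec {d : ℕ} (u v : Vec d) : inner ℝ u v = ∑ j, u j * v j := by
  simp [PiLp.inner_apply, mul_comm]

theorem norm_sq_vec {d : ℕ} (u : Vec d) : ‖u‖ ^ 2 = ∑ j, u j ^ 2 := by
  simp [EuclideanSpace.norm_sq_eq]

theorem inner_mulV_transpose {p q : ℕ} (M : Matrix (Fin p) (Fin q) ℝ) (u : Vec p) (v : Vec q) :
    inner ℝ (mulV M.transpose u) v = inner ℝ (mulV M v) u := by
  simp only [inner_vec, mulV_apply, Finset.sum_mul, Matrix.transpose_apply]
  rw [Finset.sum_comm]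
  exact Finset.sum_congr rfl fun _ _ => Finset.sum_congr rfl fun _ _ => by ring

theorem inner_strat (x y : Strat n) : inner ℝ x y = ∑ i, inner ℝ (x i) (y i) :=
  PiLp.inner_apply x y

theorem norm_sq_strat (x : Strat n) : ‖x‖ ^ 2 = ∑ i, ‖x i‖ ^ 2 :=
  PiLp.norm_sq_eq_of_L2 _ x

/-- Multiplication of the blocks by scalars. -/
def diagMap (a : Fin N → ℝ) : Strat n →ₗ[ℝ] Strat n where
  toFun x := WithLp.toLp 2 (fun i => a i • x i)
  map_add' x y := by ext i; simp
  map_smul' c x := by ext i; simp; ring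

/-- The block diagonal operator with blocks `A_i`. -/
def blockMap (A : (i : Fin N) → Matrix (Fin m) (Fin (n i)) ℝ) :
    Strat n →ₗ[ℝ] Strat (fun _ : Fin N => m) where
  toFun x := WithLp.toLp 2 (fun i => mulV (A i) (x i))
  map_add' x y := by ext i; simp [mulV_add]
  map_smul' c x := by ext i; simp [mulV_smul]

/-- The weighted Laplacian acting on blocks. -/
def lapMap (W : Matrix (Fin N) (Fin N) ℝ) :
    Strat (fun _ : Fin N => m) →ₗ[ℝ] Strat (fun _ : Fin N => m) where
  toFun z := WithLp.toLp 2 (fun i => ∑ j, W i j • (z i - z j))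
  map_add' x y := PiLp.ext fun i => by
    change ∑ j, W i j • (x i + y i - (x j + y j))
      = ∑ j, W i j • (x i - x j) + ∑ j, W i j • (y i - y j)
    rw [← Finset.sum_add_distrib]
    exact Finset.sum_congr rfl fun j _ => by rw [add_sub_add_comm, smul_add]
  map_smul' c x := PiLp.ext fun i => by
    change ∑ j, W i j • (c • x i - c • x j) = c • ∑ j, W i j • (x i - x j)
    rw [Finset.smul_sum]
    exact Finset.sum_congr rfl fun j _ => by rw [← smul_sub, smul_comm]

@[simp] theorem diagMap_apply (a : Fin N → ℝ) (x : Strat n) (i : Fin N) :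
    diagMap a x i = a i • x i := rfl

@[simp] theorem blockMap_apply (A : (i : Fin N) → Matrix (Fin m) (Fin (n i)) ℝ) (x : Strat n)
    (i : Fin N) : blockMap A x i = mulV (A i) (x i) := rfl

@[simp] theorem lapMap_apply (W : Matrix (Fin N) (Fin N) ℝ) (z : Strat (fun _ : Fin N => m))
    (i : Fin N) : lapMap W z i = ∑ j, W i j • (z i - z j) := rfl

theorem diagMap_isSymmetric (a : Fin N → ℝ) : (diagMap (n := n) a).IsSymmetric := fun x y => by
  simp [inner_strat, real_inner_smul_left, real_inner_smul_right]

variable {W : Matrix (Fin N) (Fin N) ℝ}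

/-- Swapping the two indices changes the sign of `z i - z j`, so the sum can be averaged with its
mirror image into the Dirichlet form. -/
theorem inner_lapMap (hW : W.IsSymm) (z u : Strat (fun _ : Fin N => m)) :
    inner ℝ (lapMap W z) u
      = 1 / 2 * ∑ i, ∑ j, W i j * inner ℝ (z i - z j) (u i - u j) := by
  have h1 : inner ℝ (lapMap W z) u = ∑ i, ∑ j, W i j * inner ℝ (z i - z j) (u i) := by
    simp [inner_strat, sum_inner, real_inner_smul_left]
  have h2 : ∑ i, ∑ j, W i j * inner ℝ (z i - z j) (u i)
      = -∑ i, ∑ j, W i j * inner ℝ (z i - z j) (u j) := by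
    rw [Finset.sum_comm, ← Finset.sum_neg_distrib]
    refine Finset.sum_congr rfl fun i _ => ?_
    rw [← Finset.sum_neg_distrib]
    refine Finset.sum_congr rfl fun j _ => ?_
    rw [hW.apply, ← neg_sub (z i) (z j), inner_neg_left]
    ring
  have h3 : ∑ i, ∑ j, W i j * inner ℝ (z i - z j) (u i - u j)
      = ∑ i, ∑ j, W i j * inner ℝ (z i - z j) (u i)
        - ∑ i, ∑ j, W i j * inner ℝ (z i - z j) (u j) := by
    simp only [← Finset.sum_sub_distrib, ← mul_sub, ← inner_sub_right]
  rw [h1, h3]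
  linarith

theorem lapMap_isSymmetric (hW : W.IsSymm) : (lapMap (m := m) W).IsSymmetric := fun x y => by
  rw [inner_lapMap hW, real_inner_comm, inner_lapMap hW]
  simp only [real_inner_comm]

theorem sum_lapMap (hW : W.IsSymm) (z : Strat (fun _ : Fin N => m)) :
    ∑ i, lapMap W z i = 0 := by
  refine ext_inner_right ℝ fun v => ?_
  have h := inner_lapMap hW z (WithLp.toLp 2 fun _ => v)
  simp only [inner_strat, sub_self, inner_zero_right, mul_zero, Finset.sum_const_zero] at h
  rw [sum_inner, inner_zero_left]
  exact h

/-- Weighted Cauchy–Schwarz at each node bounds `‖(L u)_i‖²` by the degree times the local Dirichlet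
energy. The factor `1/2` of the Dirichlet form accounts for the 2 in `2 * d_i * β ≤ 1`. -/
theorem lapMap_cocoercive (hW : W.IsSymm) (hW0 : ∀ i j, 0 ≤ W i j) {β : ℝ} (hβ : 0 ≤ β)
    (hd : ∀ i, 2 * (∑ j, W i j) * β ≤ 1) (u : Strat (fun _ : Fin N => m)) :
    β * ‖lapMap W u‖ ^ 2 ≤ inner ℝ (lapMap W u) u := by
  rw [inner_lapMap hW, norm_sq_strat, Finset.mul_sum, Finset.mul_sum]
  refine Finset.sum_le_sum fun i _ => ?_
  have h1 : ‖lapMap W u i‖ ^ 2 ≤ (∑ j, W i j) * ∑ j, W i j * ‖u i - u j‖ ^ 2 := by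
    have h2 : ‖lapMap W u i‖ ≤ ∑ j, W i j * ‖u i - u j‖ := by
      rw [lapMap_apply]
      refine (norm_sum_le _ _).trans (Finset.sum_le_sum fun j _ => ?_)
      rw [norm_smul, Real.norm_of_nonneg (hW0 i j)]
    refine (pow_le_pow_left₀ (norm_nonneg _) h2 2).trans ?_
    refine Finset.sum_sq_le_sum_mul_sum_of_sq_le_mul _ (fun j _ => hW0 i j)
      (fun j _ => mul_nonneg (hW0 i j) (sq_nonneg _)) (fun j _ => le_of_eq (by ring))
  have h3 : 0 ≤ ∑ j, W i j * ‖u i - u j‖ ^ 2 :=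
    Finset.sum_nonneg fun j _ => mul_nonneg (hW0 i j) (sq_nonneg _)
  simp only [real_inner_self_eq_norm_sq]
  have h4 := mul_le_mul_of_nonneg_left h1 hβ
  have h5 := mul_le_mul_of_nonneg_right (hd i) h3
  linarith

/-- The Dirichlet form vanishes, hence so does each edge term; equality then propagates along walks.
-/
theorem blocks_eq_of_lapMap_eq_zero {G : SimpleGraph (Fin N)} (hG : DualGraph G W)
    (hW0 : ∀ i j, 0 ≤ W i j) {u : Strat (fun _ : Fin N => m)} (hu : lapMap W u = 0)
    (i j : Fin N) : u i = u j := by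
  have h1 := inner_lapMap hG.symm u u
  rw [hu, inner_zero_left] at h1
  have hnn : ∀ i j, 0 ≤ W i j * inner ℝ (u i - u j) (u i - u j) := fun i j =>
    mul_nonneg (hW0 i j) real_inner_self_nonneg
  have h2 : ∑ i, ∑ j, W i j * inner ℝ (u i - u j) (u i - u j) = 0 := by linarith
  have h3 : ∀ i j, W i j * inner ℝ (u i - u j) (u i - u j) = 0 := fun i j => by
    have h4 := (Finset.sum_eq_zero_iff_of_nonneg
      (fun i _ => Finset.sum_nonneg fun j _ => hnn i j)).1 h2 i (Finset.mem_univ i)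
    exact (Finset.sum_eq_zero_iff_of_nonneg (fun j _ => hnn i j)).1 h4 j (Finset.mem_univ j)
  obtain ⟨walk⟩ := hG.connected.preconnected i j
  induction walk with
  | nil => rfl
  | cons hadj _ ih =>
    rw [← ih]
    rcases mul_eq_zero.1 (h3 _ _) with h | h
    · exact absurd h (hG.pos _ _ hadj).ne'
    · exact sub_eq_zero.1 (inner_self_eq_zero.1 h)

/-- The range of a symmetric operator is the orthogonal complement of its kernel, and the kernel
consists of constant blocks. -/
theorem exists_lapMap_eq {G : SimpleGraph (Fin N)} (hG : DualGraph G W)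
    (hW0 : ∀ i j, 0 ≤ W i j) {v : Strat (fun _ : Fin N => m)} (hv : ∑ i, v i = 0) :
    ∃ z, lapMap W z = v := by
  have h : v ∈ (lapMap (m := m) W).range := by
    rw [← Submodule.orthogonal_orthogonal (lapMap (m := m) W).range,
      (lapMap_isSymmetric hG.symm).orthogonal_range, Submodule.mem_orthogonal]
    intro u hu
    obtain ⟨i₀⟩ := hG.connected.nonempty
    have hc : ∀ i, u i = u i₀ := fun i => blocks_eq_of_lapMap_eq_zero hG hW0 hu i i₀
    rw [inner_strat]
    simp only [hc, ← inner_sum, hv, inner_zero_right]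
  exact h

theorem DualGraph.nonneg {G : SimpleGraph (Fin N)} (hG : DualGraph G W) (i j : Fin N) :
    0 ≤ W i j := by
  by_cases h : G.Adj i j
  · exact (hG.pos i j h).le
  · exact (hG.zero i j h).ge

/-- AM-GM entry by entry. The column and row sums that appear are those in the bounds on `α` and
`σ`. -/
theorem two_mul_inner_mulV_le {p q : ℕ} (M : Matrix (Fin p) (Fin q) ℝ) (v : Vec q) (u : Vec p) :
    2 * inner ℝ (mulV M v) u
      ≤ ∑ j, (∑ r, |M r j|) * v j ^ 2 + ∑ r, (∑ j, |M r j|) * u r ^ 2 := by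
  have h1 : ∑ j, (∑ r, |M r j|) * v j ^ 2 = ∑ r, ∑ j, |M r j| * v j ^ 2 := by
    rw [Finset.sum_comm]
    simp only [Finset.sum_mul]
  rw [h1]
  simp only [inner_vec, mulV_apply, Finset.sum_mul, Finset.mul_sum, ← Finset.sum_add_distrib]
  refine Finset.sum_le_sum fun r _ => Finset.sum_le_sum fun j _ => ?_
  rcases abs_cases (M r j) with ⟨h, h'⟩ | ⟨h, h'⟩ <;> rw [h] <;>
    nlinarith [mul_nonneg (abs_nonneg (M r j)) (sq_nonneg (v j - u r)),
      mul_nonneg (abs_nonneg (M r j)) (sq_nonneg (v j + u r))]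

theorem two_mul_inner_lapMap_le (hW : W.IsSymm) (hW0 : ∀ i j, 0 ≤ W i j)
    (z l : Strat (fun _ : Fin N => m)) :
    2 * inner ℝ (lapMap W z) l
      ≤ ∑ i, 2 * (∑ j, W i j) * ‖z i‖ ^ 2 + ∑ i, 2 * (∑ j, W i j) * ‖l i‖ ^ 2 := by
  have h1 : inner ℝ (lapMap W z) l = ∑ i, ∑ j, W i j * inner ℝ (z i - z j) (l i) := by
    simp [inner_strat, sum_inner, real_inner_smul_left]
  have h2 : ∑ i, ∑ j, W i j * ‖z j‖ ^ 2 = ∑ i, (∑ j, W i j) * ‖z i‖ ^ 2 := by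
    rw [Finset.sum_comm]
    refine Finset.sum_congr rfl fun i _ => ?_
    rw [Finset.sum_mul]
    exact Finset.sum_congr rfl fun j _ => by rw [hW.apply]
  have key : ∀ a b : Vec m, 2 * inner ℝ a b ≤ ‖a‖ ^ 2 + ‖b‖ ^ 2 := fun a b => by
    nlinarith [real_inner_le_norm a b, sq_nonneg (‖a‖ - ‖b‖)]
  have h3 : ∀ i j, W i j * (2 * inner ℝ (z i - z j) (l i))
      ≤ W i j * ‖z i‖ ^ 2 + W i j * ‖z j‖ ^ 2 + 2 * (W i j * ‖l i‖ ^ 2) := fun i j => by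
    have a1 := key (z i) (l i)
    have a2 := key (-z j) (l i)
    rw [norm_neg] at a2
    have : 2 * inner ℝ (z i - z j) (l i) ≤ ‖z i‖ ^ 2 + ‖z j‖ ^ 2 + 2 * ‖l i‖ ^ 2 := by
      rw [sub_eq_add_neg, inner_add_left]
      linarith
    nlinarith [mul_le_mul_of_nonneg_left this (hW0 i j)]
  have h4 := Finset.sum_le_sum fun i (_ : i ∈ Finset.univ) =>
    Finset.sum_le_sum fun j (_ : j ∈ Finset.univ) => h3 i j
  simp only [Finset.sum_add_distrib] at h4
  rw [h2] at h4
  simp only [← Finset.mul_sum, ← Finset.sum_mul] at h4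
  have h5 : ∑ i, ∑ j, W i j * (2 * inner ℝ (z i - z j) (l i)) = 2 * inner ℝ (lapMap W z) l := by
    rw [h1]
    simp only [Finset.mul_sum]
    exact Finset.sum_congr rfl fun i _ => Finset.sum_congr rfl fun j _ => by ring
  rw [h5] at h4
  have h6 : ∀ y : Strat (fun _ : Fin N => m), ∑ i, 2 * (∑ j, W i j) * ‖y i‖ ^ 2
      = 2 * ∑ i, (∑ j, W i j) * ‖y i‖ ^ 2 := fun y => by
    rw [Finset.mul_sum]
    exact Finset.sum_congr rfl fun i _ => by ring
  rw [h6, h6]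
  linarith

end blocks

/-! ### The algorithm as a preconditioned iteration, its zeros, and convergence along a path. -/

section operator

variable {N : ℕ} {n : Fin N → ℕ} {m : ℕ} {S : Type*} (g : Game N n m S) (p : Params N m)

/-- The undamped iteration `(x̃, z̃, λ̃)`. -/
def tilde (Fhat : Strat n) (w : State n m) : State n m :=
  (xTilde g p Fhat w, zTilde p w, lamTilde g p Fhat w)

theorem step_eq (Fhat : Strat n) (w : State n m) :
    step g p Fhat w = (1 - p.δ) • w + p.δ • tilde g p Fhat w := rfl

/-- The squared norm induced by the preconditioning matrix. -/
def quad (w : State n m) : ℝ :=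
  preQuad (diagMap fun i => (p.α i)⁻¹) (diagMap fun i => (p.ν i)⁻¹)
    (diagMap fun i => (p.σ i)⁻¹) (blockMap g.A) (lapMap p.W) w.1 (WithLp.toLp 2 w.2.1)
    (WithLp.toLp 2 w.2.2)

theorem continuous_quad : Continuous (quad g p) := by
  have h1 : ∀ {n' : Fin N → ℕ} {n'' : Fin N → ℕ} (T : Strat n' →ₗ[ℝ] Strat n''), Continuous T :=
    fun T => T.continuous_of_finiteDimensional
  have hz : Continuous fun w : State n m => (WithLp.toLp 2 w.2.1 : Strat fun _ : Fin N => m) := by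
    fun_prop
  have hl : Continuous fun w : State n m => (WithLp.toLp 2 w.2.2 : Strat fun _ : Fin N => m) := by
    fun_prop
  unfold quad preQuad
  exact (((((h1 _).comp continuous_fst).inner continuous_fst).add
    (((h1 _).comp hz).inner hz)).add (((h1 _).comp hl).inner hl)).sub
    (continuous_const.mul (((h1 _).comp continuous_fst).inner hl)) |>.sub
    (continuous_const.mul (((h1 _).comp hz).inner hl))

theorem quad_zero : quad g p (0 : State n m) = 0 := by
  simp [quad, preQuad]

theorem quad_convexCombo (t : ℝ) (u v : State n m) :
    quad g p ((1 - t) • u + t • v)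
      = (1 - t) * quad g p u + t * quad g p v - t * (1 - t) * quad g p (u - v) :=
  preQuad_convexCombo _ _ _ _ _ t u.1 v.1 (WithLp.toLp 2 u.2.1) (WithLp.toLp 2 v.2.1)
    (WithLp.toLp 2 u.2.2) (WithLp.toLp 2 v.2.2)

variable {g p} {η ℓ β τ : ℝ} {G : SimpleGraph (Fin N)}

/-- Diagonal dominance: each step-size bound says that an inverse step size exceeds `τ` by the
absolute off-diagonal entries in its row. -/
theorem le_preQuad (hG : DualGraph G p.W) (hs : StepAssumptions g p η ℓ β τ) (x : Strat n)
    (z l : Strat (fun _ : Fin N => m)) :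
    τ * (‖x‖ ^ 2 + ‖z‖ ^ 2 + ‖l‖ ^ 2)
      ≤ preQuad (diagMap fun i => (p.α i)⁻¹) (diagMap fun i => (p.ν i)⁻¹)
        (diagMap fun i => (p.σ i)⁻¹) (blockMap g.A) (lapMap p.W) x z l := by
  have hA : 2 * inner ℝ (blockMap g.A x) l ≤ ∑ i, (∑ j, (∑ r, |g.A i r j|) * x i j ^ 2
      + ∑ r, (∑ j, |g.A i r j|) * l i r ^ 2) := by
    rw [inner_strat, Finset.mul_sum]
    exact Finset.sum_le_sum fun i _ => two_mul_inner_mulV_le _ _ _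
  have hL := two_mul_inner_lapMap_le hG.symm hG.nonneg z l
  have hx : ∀ i, ∑ j, (∑ r, |g.A i r j|) * x i j ^ 2 + τ * ‖x i‖ ^ 2
      ≤ (p.α i)⁻¹ * ‖x i‖ ^ 2 := fun i => by
    rw [norm_sq_vec, Finset.mul_sum, Finset.mul_sum, ← Finset.sum_add_distrib]
    refine Finset.sum_le_sum fun j _ => ?_
    rw [← add_mul]
    refine mul_le_mul_of_nonneg_right ?_ (sq_nonneg _)
    rw [← one_div, le_div_iff₀' (hs.alpha_pos i)]
    exact hs.alpha i j
  have hz : ∀ i, 2 * (∑ j, p.W i j) * ‖z i‖ ^ 2 + τ * ‖z i‖ ^ 2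
      ≤ (p.ν i)⁻¹ * ‖z i‖ ^ 2 := fun i => by
    rw [← add_mul]
    refine mul_le_mul_of_nonneg_right ?_ (sq_nonneg _)
    rw [← one_div, le_div_iff₀' (hs.nu_pos i)]
    exact hs.nu i
  have hl : ∀ i, ∑ r, (∑ j, |g.A i r j|) * l i r ^ 2 + 2 * (∑ j, p.W i j) * ‖l i‖ ^ 2
      + τ * ‖l i‖ ^ 2 ≤ (p.σ i)⁻¹ * ‖l i‖ ^ 2 := fun i => by
    have hsig : ∀ r, p.σ i * ((∑ j, |g.A i r j|) + 2 * (∑ j, p.W i j) + τ) ≤ 1 := hs.sigma i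
    generalize ∑ j, p.W i j = d at hsig ⊢
    rw [norm_sq_vec, Finset.mul_sum, Finset.mul_sum, Finset.mul_sum, ← Finset.sum_add_distrib,
      ← Finset.sum_add_distrib]
    refine Finset.sum_le_sum fun r _ => ?_
    rw [← add_mul, ← add_mul]
    refine mul_le_mul_of_nonneg_right ?_ (sq_nonneg _)
    rw [← one_div, le_div_iff₀' (hs.sigma_pos i)]
    exact hsig r
  have sx := Finset.sum_le_sum fun i (_ : i ∈ Finset.univ) => hx i
  have sz := Finset.sum_le_sum fun i (_ : i ∈ Finset.univ) => hz i
  have sl := Finset.sum_le_sum fun i (_ : i ∈ Finset.univ) => hl i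
  simp only [Finset.sum_add_distrib, ← Finset.mul_sum] at sx sz sl hA
  rw [preQuad]
  have e : ∀ {n' : Fin N → ℕ} (a : Fin N → ℝ) (y : Strat n'),
      inner ℝ (diagMap a y) y = ∑ i, a i * ‖y i‖ ^ 2 := fun a y => by
    simp [inner_strat, real_inner_smul_left]
  rw [e, e, e]
  simp only [norm_sq_strat]
  linarith

/-- The product type `State` carries the sup norm, which is dominated by the Euclidean norms of
`le_preQuad`. -/
theorem le_quad (hG : DualGraph G p.W) (hs : StepAssumptions g p η ℓ β τ) (w : State n m) :
    τ * ‖w‖ ^ 2 ≤ quad g p w := by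
  refine le_trans ?_ (le_preQuad hG hs _ _ _)
  refine mul_le_mul_of_nonneg_left ?_ hs.tau_pos.le
  set z : Strat (fun _ : Fin N => m) := WithLp.toLp 2 w.2.1
  set l : Strat (fun _ : Fin N => m) := WithLp.toLp 2 w.2.2
  have hz : ‖w.2.1‖ ≤ ‖z‖ :=
    (pi_norm_le_iff_of_nonneg (norm_nonneg _)).2 fun i => PiLp.norm_apply_le z i
  have hl : ‖w.2.2‖ ≤ ‖l‖ :=
    (pi_norm_le_iff_of_nonneg (norm_nonneg _)).2 fun i => PiLp.norm_apply_le l i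
  have hw : ‖w‖ = max ‖w.1‖ (max ‖w.2.1‖ ‖w.2.2‖) := rfl
  rcases max_choice ‖w.1‖ (max ‖w.2.1‖ ‖w.2.2‖) with h | h
  · rw [hw, h]
    nlinarith [sq_nonneg ‖z‖, sq_nonneg ‖l‖]
  · rcases max_choice ‖w.2.1‖ ‖w.2.2‖ with h' | h'
    · rw [hw, h, h']
      nlinarith [sq_nonneg ‖w.1‖, sq_nonneg ‖l‖, norm_nonneg w.2.1]
    · rw [hw, h, h']
      nlinarith [sq_nonneg ‖w.1‖, sq_nonneg ‖z‖, norm_nonneg w.2.2]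

theorem dom_isComplete (hcon : g.ConstraintAssumptions) (i : Fin N) : IsComplete (g.dom i) :=
  (hcon.compact i).isComplete

theorem domain_isClosed (hcon : g.ConstraintAssumptions) : IsClosed g.domain := by
  have : g.domain = ⋂ i, {x : Strat n | x i ∈ g.dom i} := by ext x; simp [Game.domain]
  rw [this]
  exact isClosed_iInter fun i => (hcon.compact i).isClosed.preimage (by fun_prop)

theorem xTilde_mem (hcon : g.ConstraintAssumptions) (Fhat : Strat n) (w : State n m) :
    xTilde g p Fhat w ∈ g.domain := fun i =>
  (proj_spec (hcon.nonempty i) (dom_isComplete hcon i) (hcon.convex i) _).1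

theorem step_mem (hcon : g.ConstraintAssumptions) (hs : StepAssumptions g p η ℓ β τ)
    (Fhat : Strat n) {w : State n m} (hw : w.1 ∈ g.domain) :
    (step g p Fhat w).1 ∈ g.domain := fun i =>
  hcon.convex i (hw i) (xTilde_mem hcon Fhat w i) (sub_nonneg.2 hs.delta_le) hs.delta_pos.le
    (by ring)

theorem continuous_xTilde (hcon : g.ConstraintAssumptions) :
    Continuous fun q : Strat n × State n m => xTilde g p q.1 q.2 := by
  unfold xTilde
  refine (PiLp.continuous_toLp 2 _).comp (continuous_pi fun i =>
    (continuous_proj (hcon.nonempty i) (dom_isComplete hcon i) (hcon.convex i)).comp ?_)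
  have := (continuous_mulV (g.A i).transpose).comp
    (by fun_prop : Continuous fun q : Strat n × State n m => q.2.2.2 i)
  simp only [Function.comp_def] at this
  fun_prop

theorem continuous_zTilde : Continuous fun w : State n m => zTilde p w := by
  unfold zTilde
  fun_prop

theorem continuous_lamTilde (hcon : g.ConstraintAssumptions) :
    Continuous fun q : Strat n × State n m => lamTilde g p q.1 q.2 := by
  unfold lamTilde
  refine continuous_pi fun i =>
    (continuous_proj (orthant_nonempty m) (orthant_isComplete m) (orthant_convex m)).comp ?_
  have h1 : Continuous fun q : Strat n × State n m => xTilde g p q.1 q.2 i :=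
    (PiLp.continuous_apply 2 _ i).comp (continuous_xTilde hcon)
  have h2 : Continuous fun q : Strat n × State n m =>
      mulV (g.A i) ((2 : ℝ) • xTilde g p q.1 q.2 i - q.2.1 i) :=
    (continuous_mulV (g.A i)).comp (by fun_prop)
  have h3 : ∀ j, Continuous fun q : Strat n × State n m => zTilde p q.2 j := fun j =>
    (continuous_apply j).comp (continuous_zTilde.comp continuous_snd)
  have h4 : Continuous fun q : Strat n × State n m => ∑ j, p.W i j •
        ((2 : ℝ) • (zTilde p q.2 i - zTilde p q.2 j) - (q.2.2.1 i - q.2.2.1 j)) :=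
    continuous_finsetSum _ fun j _ => by
      have := h3 i
      have := h3 j
      fun_prop
  have h5 : Continuous fun q : Strat n × State n m => ∑ j, p.W i j •
        (q.2.2.2 i - q.2.2.2 j) := by fun_prop
  have h6 : Continuous fun q : Strat n × State n m => q.2.2.2 i := by fun_prop
  exact ((h6.add ((h2.sub continuous_const).const_smul (p.σ i))).add
    (h4.const_smul (p.σ i))).sub (h5.const_smul (p.σ i))

theorem continuous_tilde (hcon : g.ConstraintAssumptions) :
    Continuous fun q : Strat n × State n m => tilde g p q.1 q.2 :=
  (continuous_xTilde hcon).prodMk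
    ((continuous_zTilde.comp continuous_snd).prodMk (continuous_lamTilde hcon))

/-- Projections are nonexpansive, so noise moves block `i` of `x̃` by at most `α_i ‖ε_i‖`. This
exchanges the noisy `x̃` for one that does not depend on the current samples. -/
theorem inner_xTilde_sub_le (hcon : g.ConstraintAssumptions) (hs : StepAssumptions g p η ℓ β τ)
    (f ε : Strat n) (w : State n m) :
    |inner ℝ ε (xTilde g p (f + ε) w - xTilde g p f w)| ≤ (∑ i, p.α i) * ‖ε‖ ^ 2 := by
  rw [inner_strat, norm_sq_strat, Finset.mul_sum]
  refine (Finset.abs_sum_le_sum_abs _ _).trans (Finset.sum_le_sum fun i _ => ?_)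
  have h1 : ‖(xTilde g p (f + ε) w - xTilde g p f w) i‖ ≤ p.α i * ‖ε i‖ := by
    refine (norm_proj_sub_proj_le (hcon.nonempty i) (dom_isComplete hcon i) (hcon.convex i)
      _ _).trans (le_of_eq ?_)
    rw [← Real.norm_of_nonneg (hs.alpha_pos i).le, ← norm_smul, ← norm_neg (p.α i • ε i),
      Real.norm_of_nonneg (hs.alpha_pos i).le]
    congr 1
    simp only [PiLp.add_apply, smul_add]
    abel
  refine (abs_real_inner_le_norm _ _).trans ?_
  have h2 := mul_le_mul_of_nonneg_left h1 (norm_nonneg (ε i))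
  have h3 := mul_le_mul_of_nonneg_right (Finset.single_le_sum (f := p.α)
    (fun j _ => (hs.alpha_pos j).le) (Finset.mem_univ i)) (sq_nonneg ‖ε i‖)
  linarith

variable {Ξ : Type*} [MeasurableSpace Ξ] {P : Measure Ξ} {ξ : Ξ → S}

variable (g p P ξ) in
/-- Solutions of the extended inclusion with local multipliers and auxiliary variables. -/
structure IsZero (w : State n m) : Prop where
  mem : w.1 ∈ g.domain
  primal : ∀ i, ∀ y ∈ g.dom i,
    0 ≤ inner ℝ (g.F P ξ w.1 i + mulV (g.A i).transpose (w.2.2 i)) (y - w.1 i)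
  consensus : lapMap p.W (WithLp.toLp 2 w.2.2 : Strat fun _ : Fin N => m) = 0
  nonneg : ∀ i, w.2.2 i ∈ orthant m
  dual : ∀ i, ∀ μ ∈ orthant m,
    inner ℝ (mulV (g.A i) (w.1 i) - p.b i
      + lapMap p.W (WithLp.toLp 2 w.2.1 : Strat fun _ : Fin N => m) i) (μ - w.2.2 i) ≤ 0

theorem isZero_of_tilde_eq (hcon : g.ConstraintAssumptions) (hs : StepAssumptions g p η ℓ β τ)
    {w : State n m} (hw : tilde g p (g.F P ξ w.1) w = w) : IsZero g p P ξ w := by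
  have hx : ∀ i, proj (g.dom i) (w.1 i - p.α i • (g.F P ξ w.1 i
      + mulV (g.A i).transpose (w.2.2 i))) = w.1 i := fun i =>
    congrArg (fun v : State n m => v.1 i) hw
  have hz : ∀ i, w.2.1 i - p.ν i • ∑ j, p.W i j • (w.2.2 i - w.2.2 j) = w.2.1 i := fun i =>
    congrArg (fun v : State n m => v.2.1 i) hw
  have hl : ∀ i, lamTilde g p (g.F P ξ w.1) w i = w.2.2 i := fun i =>
    congrArg (fun v : State n m => v.2.2 i) hw
  have hc : ∀ i, ∑ j, p.W i j • (w.2.2 i - w.2.2 j) = 0 := fun i => by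
    have h := hz i
    rw [sub_eq_self, smul_eq_zero] at h
    exact h.resolve_left (hs.nu_pos i).ne'
  have hxt : xTilde g p (g.F P ξ w.1) w = w.1 := congrArg Prod.fst hw
  have hzt : zTilde p w = w.2.1 := congrArg (fun v : State n m => v.2.1) hw
  refine ⟨?_, fun i y hy => ?_, PiLp.ext fun i => hc i, fun i => ?_, fun i μ hμ => ?_⟩
  · rw [← hxt]
    exact xTilde_mem hcon _ _
  · have h := (proj_spec (hcon.nonempty i) (dom_isComplete hcon i) (hcon.convex i)
      (w.1 i - p.α i • (g.F P ξ w.1 i + mulV (g.A i).transpose (w.2.2 i)))).2 y hy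
    rw [hx i, sub_sub_cancel_left, inner_neg_left, real_inner_smul_left] at h
    exact nonneg_of_mul_nonneg_right (by linarith) (hs.alpha_pos i)
  · rw [← hl i]
    exact (proj_spec (orthant_nonempty m) (orthant_isComplete m) (orthant_convex m) _).1
  · have h := (proj_spec (orthant_nonempty m) (orthant_isComplete m) (orthant_convex m)
      (w.2.2 i + p.σ i • (mulV (g.A i) ((2 : ℝ) • xTilde g p (g.F P ξ w.1) w i - w.1 i) - p.b i)
    + p.σ i • ∑ j, p.W i j •
        ((2 : ℝ) • (zTilde p w i - zTilde p w j) - (w.2.1 i - w.2.1 j))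
    - p.σ i • ∑ j, p.W i j • (w.2.2 i - w.2.2 j))).2 μ hμ
    have hl' := hl i
    rw [lamTilde] at hl'
    rw [hl', hxt, hzt, hc i] at h
    have e : w.2.2 i + p.σ i • (mulV (g.A i) ((2 : ℝ) • w.1 i - w.1 i) - p.b i)
      + p.σ i • ∑ j, p.W i j • ((2 : ℝ) • (w.2.1 i - w.2.1 j) - (w.2.1 i - w.2.1 j))
      - p.σ i • (0 : Vec m) - w.2.2 i = p.σ i • (mulV (g.A i) (w.1 i) - p.b i
        + lapMap p.W (WithLp.toLp 2 w.2.1 : Strat fun _ : Fin N => m) i) := by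
      rw [lapMap_apply]
      simp only [two_smul, add_sub_cancel_right, smul_zero, sub_zero, smul_add]
      abel
    rw [e, real_inner_smul_left] at h
    exact nonpos_of_mul_nonpos_right h (hs.sigma_pos i)

/-- Connectedness makes the multipliers equal. Summing the dual conditions over the players then
removes the Laplacian term and assembles `b`. -/
theorem IsZero.isKKT (hG : DualGraph G p.W) (hb : ∑ i, p.b i = g.b) {w : State n m}
    (hw : IsZero g p P ξ w) (i₀ : Fin N) :
    w.2.2 = (fun _ => w.2.2 i₀) ∧ g.IsKKT P ξ w.1 (w.2.2 i₀) := by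
  have hc : ∀ i, w.2.2 i = w.2.2 i₀ := fun i =>
    blocks_eq_of_lapMap_eq_zero hG hG.nonneg hw.consensus i i₀
  refine ⟨funext hc, fun i => ⟨hw.mem i, fun y hy => ?_⟩, hw.nonneg i₀, fun μ hμ => ?_⟩
  · have h := hw.primal i y hy
    rw [hc i] at h
    rw [inner_neg_left]
    linarith
  · have h : ∑ i, inner ℝ (mulV (g.A i) (w.1 i) - p.b i
      + lapMap p.W (WithLp.toLp 2 w.2.1 : Strat fun _ : Fin N => m) i) (μ - w.2.2 i₀) ≤ 0 :=
      Finset.sum_nonpos fun i _ => by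
        have h := hw.dual i μ hμ
        rwa [hc i] at h
    rw [← sum_inner, Finset.sum_add_distrib, sum_lapMap hG.symm, Finset.sum_sub_distrib, hb,
      add_zero] at h
    exact h

/-- Testing each KKT system with the other point and adding cancels the multipliers, leaving `⟨𝔽 w -
𝔽 v, w - v⟩ ≤ 0`. -/
theorem IsZero.fst_eq (hF : g.PseudoGradientAssumptions P ξ η ℓ) (hG : DualGraph G p.W)
    (hb : ∑ i, p.b i = g.b) {w v : State n m} (hw : IsZero g p P ξ w) (hv : IsZero g p P ξ v) :
    w.1 = v.1 := by
  obtain ⟨i₀⟩ := hG.connected.nonempty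
  obtain ⟨-, hw1, hw2⟩ := hw.isKKT hG hb i₀
  obtain ⟨-, hv1, hv2⟩ := hv.isKKT hG hb i₀
  have h1 := hw2.2 _ hv2.1
  have h2 := hv2.2 _ hw2.1
  have e : ∀ (x y : Strat n) (l : Vec m),
      ∑ i, inner ℝ (-(g.F P ξ x i + mulV (g.A i).transpose l)) (y i - x i)
        = -inner ℝ (g.F P ξ x) (y - x) - inner ℝ (g.Ax y - g.Ax x) l := fun x y l => by
    simp only [inner_strat, Game.Ax, ← Finset.sum_sub_distrib, ← mulV_sub, sum_inner,
      ← Finset.sum_neg_distrib, inner_neg_left, inner_add_left, inner_mulV_transpose]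
    exact Finset.sum_congr rfl fun i _ => by rw [PiLp.sub_apply]; ring
  have h3 := Finset.sum_nonpos fun i (_ : i ∈ Finset.univ) => (hw1 i).2 _ (hv.mem i)
  have h4 := Finset.sum_nonpos fun i (_ : i ∈ Finset.univ) => (hv1 i).2 _ (hw.mem i)
  rw [e] at h3 h4
  have h5 := hF.stronglyMonotone _ hw.mem _ hv.mem
  have h6 : η * ‖w.1 - v.1‖ ^ 2 ≤ 0 := by
    simp only [inner_sub_left, inner_sub_right] at *
    linarith
  have h7 : ‖w.1 - v.1‖ ^ 2 ≤ 0 := nonpos_of_mul_nonpos_right h6 hF.eta_pos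
  exact sub_eq_zero.1 (norm_eq_zero.1 (pow_eq_zero_iff two_ne_zero |>.1
    (le_antisymm h7 (sq_nonneg _))))

theorem quad_tilde_sub_le (hcon : g.ConstraintAssumptions)
    (hF : g.PseudoGradientAssumptions P ξ η ℓ) (hG : DualGraph G p.W)
    (hs : StepAssumptions g p η ℓ β τ) {w v : State n m} (hw : w.1 ∈ g.domain)
    (hv : IsZero g p P ξ v) (ε : Strat n) :
    quad g p (tilde g p (g.F P ξ w.1 + ε) w - v)
      ≤ quad g p (w - v)
        - (1 - 1 / (2 * β * τ)) * quad g p (w - tilde g p (g.F P ξ w.1 + ε) w)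
        - 2 * inner ℝ ε (xTilde g p (g.F P ξ w.1 + ε) w - v.1) := by
  set f := g.F P ξ w.1
  have hdeg : ∀ i, 2 * (∑ j, p.W i j) * β ≤ 1 := hs.beta_deg
  refine preQuad_forwardBackward_le _ _ _ _ _ (diagMap_isSymmetric _) (diagMap_isSymmetric _)
    (diagMap_isSymmetric _) (lapMap_isSymmetric hG.symm) hs.beta_pos hs.tau_pos
    (le_preQuad hG hs) w.1 (xTilde g p (f + ε) w) v.1 f (g.F P ξ v.1) ε
    (WithLp.toLp 2 w.2.1) (WithLp.toLp 2 (zTilde p w)) (WithLp.toLp 2 v.2.1)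
    (WithLp.toLp 2 w.2.2) (WithLp.toLp 2 (lamTilde g p (f + ε) w)) (WithLp.toLp 2 v.2.2)
    (WithLp.toLp 2 p.b) ?_ ?_ ?_ ?_ hv.consensus ?_ ?_
    (lapMap_cocoercive hG.symm hG.nonneg hs.beta_pos.le hdeg _)
  · simp only [inner_strat, ← Finset.sum_add_distrib]
    refine Finset.sum_le_sum fun i _ => ?_
    have h := (proj_spec (hcon.nonempty i) (dom_isComplete hcon i) (hcon.convex i)
      (w.1 i - p.α i • ((f + ε) i + mulV (g.A i).transpose (w.2.2 i)))).2 _ (hv.mem i)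
    change inner ℝ (_ - xTilde g p (f + ε) w i) (v.1 i - xTilde g p (f + ε) w i) ≤ 0 at h
    rw [sub_right_comm, inner_sub_left, real_inner_smul_left, inner_add_left,
      inner_mulV_transpose] at h
    simp only [diagMap_apply, blockMap_apply, PiLp.sub_apply, real_inner_smul_left]
    rw [inv_mul_le_iff₀ (hs.alpha_pos i)]
    linarith
  · refine PiLp.ext fun i => ?_
    have : (p.ν i)⁻¹ • (w.2.1 i - (w.2.1 i - p.ν i • ∑ j, p.W i j • (w.2.2 i - w.2.2 j)))
        = ∑ j, p.W i j • (w.2.2 i - w.2.2 j) := by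
      rw [sub_sub_cancel, inv_smul_smul₀ (hs.nu_pos i).ne']
    exact this
  · rw [inner_strat]
    refine Finset.sum_nonpos fun i _ => ?_
    have h := (proj_spec (orthant_nonempty m) (orthant_isComplete m) (orthant_convex m)
      (w.2.2 i + p.σ i • (mulV (g.A i) ((2 : ℝ) • xTilde g p (f + ε) w i - w.1 i) - p.b i)
    + p.σ i • ∑ j, p.W i j •
        ((2 : ℝ) • (zTilde p w i - zTilde p w j) - (w.2.1 i - w.2.1 j))
    - p.σ i • ∑ j, p.W i j • (w.2.2 i - w.2.2 j))).2 _ (hv.nonneg i)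
    change inner ℝ (_ - lamTilde g p (f + ε) w i) (v.2.2 i - lamTilde g p (f + ε) w i) ≤ 0 at h
    have e : w.2.2 i + p.σ i • (mulV (g.A i) ((2 : ℝ) • xTilde g p (f + ε) w i - w.1 i) - p.b i)
        + p.σ i • ∑ j, p.W i j •
            ((2 : ℝ) • (zTilde p w i - zTilde p w j) - (w.2.1 i - w.2.1 j))
        - p.σ i • ∑ j, p.W i j • (w.2.2 i - w.2.2 j) - lamTilde g p (f + ε) w i
        = p.σ i • ((p.σ i)⁻¹ • (w.2.2 i - lamTilde g p (f + ε) w i)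
          + mulV (g.A i) ((2 : ℝ) • xTilde g p (f + ε) w i - w.1 i) - p.b i
          + ∑ j, p.W i j • ((2 : ℝ) • zTilde p w i - w.2.1 i - ((2 : ℝ) • zTilde p w j - w.2.1 j))
          - ∑ j, p.W i j • (w.2.2 i - w.2.2 j)) := by
      have e' : ∀ j, (2 : ℝ) • zTilde p w i - w.2.1 i - ((2 : ℝ) • zTilde p w j - w.2.1 j)
          = (2 : ℝ) • (zTilde p w i - zTilde p w j) - (w.2.1 i - w.2.1 j) := fun j => by
        rw [smul_sub]; abel
      rw [Finset.sum_congr rfl fun j _ => congrArg (p.W i j • ·) (e' j)]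
      generalize ∑ j, p.W i j • ((2 : ℝ) • (zTilde p w i - zTilde p w j)
        - (w.2.1 i - w.2.1 j)) = s₁
      generalize ∑ j, p.W i j • (w.2.2 i - w.2.2 j) = s₂
      generalize lamTilde g p (f + ε) w i = s₃
      generalize mulV (g.A i) _ = s₄
      have hσ := smul_inv_smul₀ (hs.sigma_pos i).ne' (w.2.2 i - s₃)
      simp only [smul_sub, smul_add] at hσ ⊢
      rw [hσ]
      abel
    rw [e, real_inner_smul_left] at h
    exact nonpos_of_mul_nonpos_right h (hs.sigma_pos i)
  · simp only [inner_strat, ← Finset.sum_add_distrib]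
    refine Finset.sum_nonneg fun i _ => ?_
    have h := hv.primal i _ (xTilde_mem (p := p) hcon (f + ε) w i)
    rw [inner_add_left, inner_mulV_transpose] at h
    exact h
  · rw [inner_strat]
    exact Finset.sum_nonpos fun i _ => hv.dual i _
      (proj_spec (orthant_nonempty m) (orthant_isComplete m) (orthant_convex m) _).1
  -- Cocoercivity of `𝔽` on `Ω`: `β‖Δ𝔽‖² ≤ βℓ²‖Δx‖² ≤ η‖Δx‖²`.
  · refine le_trans ?_ (hF.stronglyMonotone _ hw _ hv.mem)
    have h1 := hF.lipschitz _ hw _ hv.mem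
    have h2 : ‖f - g.F P ξ v.1‖ ^ 2 ≤ ℓ ^ 2 * ‖w.1 - v.1‖ ^ 2 := by
      rw [← mul_pow]
      exact pow_le_pow_left₀ (norm_nonneg _) h1 2
    have h3 := mul_le_mul_of_nonneg_left h2 hs.beta_pos.le
    have h4 := mul_le_mul_of_nonneg_right hs.beta_F (sq_nonneg ‖w.1 - v.1‖)
    linarith

/-- Convergence of the iteration along one path of errors. -/
theorem exists_tendsto_of_errors (hcon : g.ConstraintAssumptions)
    (hF : g.PseudoGradientAssumptions P ξ η ℓ) (hb : ∑ i, p.b i = g.b) (hG : DualGraph G p.W)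
    (hs : StepAssumptions g p η ℓ β τ) {v : State n m} (hv : IsZero g p P ξ v)
    {w : ℕ → State n m} {ε : ℕ → Strat n} (hw0 : (w 0).1 ∈ g.domain)
    (hw : ∀ k, w (k + 1) = step g p (g.F P ξ (w k).1 + ε k) (w k))
    (hε : Summable fun k => ‖ε k‖ ^ 2)
    (hM : ∃ s, Tendsto (fun K => ∑ k ∈ Finset.range K,
      inner ℝ (ε k) (xTilde g p (g.F P ξ (w k).1) (w k) - v.1)) atTop (𝓝 s)) :
    ∃ u, IsZero g p P ξ u ∧ Tendsto w atTop (𝓝 u) := by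
  have hwd : ∀ k, (w k).1 ∈ g.domain := fun k => by
    induction k with
    | zero => exact hw0
    | succ k ih =>
      rw [hw]
      exact step_mem hcon hs _ ih
  obtain ⟨s, hM⟩ := hM
  set t : ℕ → State n m := fun k => tilde g p (g.F P ξ (w k).1 + ε k) (w k) with ht
  set c : ℝ := 1 - 1 / (2 * β * τ) with hc
  have hc0 : 0 < c := by
    rw [hc, sub_pos, div_lt_one (by linarith [hs.tau])]
    exact hs.tau
  have hq0 : ∀ u : State n m, 0 ≤ quad g p u := fun u =>
    le_trans (mul_nonneg hs.tau_pos.le (sq_nonneg _)) (le_quad hG hs u)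
  obtain ⟨κ, hκ⟩ : ∃ κ, κ = 2 * (∑ i, p.α i) := ⟨_, rfl⟩
  set e : ℕ → ℝ := fun k => p.δ * (κ * ‖ε k‖ ^ 2
    - 2 * inner ℝ (ε k) (xTilde g p (g.F P ξ (w k).1) (w k) - v.1)) with he
  have hes : ∃ s', Tendsto (fun K => ∑ k ∈ Finset.range K, e k) atTop (𝓝 s') := by
    have h1 := (hε.mul_left κ).hasSum.tendsto_sum_nat
    have h2 := (h1.sub (hM.const_mul 2)).const_mul p.δ
    refine ⟨_, h2.congr fun K => ?_⟩
    rw [Finset.mul_sum, ← Finset.sum_sub_distrib, Finset.mul_sum]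
  obtain ⟨s', hes⟩ := hes
  have hdec : ∀ u, IsZero g p P ξ u → ∀ k,
      quad g p (w (k + 1) - u) ≤ quad g p (w k - u) - p.δ * c * quad g p (w k - t k) + e k := by
    intro u hu k
    have h1 := quad_tilde_sub_le hcon hF hG hs (hwd k) hu (ε k)
    -- The noise term sees only the `x`-part of the zero, so the series assumed to converge for `v`
    -- serves for every `u`.
    rw [IsZero.fst_eq hF hG hb hu hv] at h1
    have h2 := (abs_le.1 (inner_xTilde_sub_le hcon hs (g.F P ξ (w k).1) (ε k) (w k))).1
    have h3 : w (k + 1) - u = (1 - p.δ) • (w k - u) + p.δ • (t k - u) := by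
      rw [hw, step_eq, smul_sub, smul_sub, sub_smul, sub_smul, one_smul, one_smul]
      abel
    rw [h3, quad_convexCombo, sub_sub_sub_cancel_right]
    have h4 : quad g p (t k - u) ≤ quad g p (w k - u) - c * quad g p (w k - t k)
        + (κ * ‖ε k‖ ^ 2
          - 2 * inner ℝ (ε k) (xTilde g p (g.F P ξ (w k).1) (w k) - v.1)) := by
      rw [hκ]
      rw [inner_sub_right] at h1 h2 ⊢
      linarith
    have h5 := mul_le_mul_of_nonneg_left h4 hs.delta_pos.le
    -- Damping yields a further decrease by this amount, which is discarded.
    have h6 : 0 ≤ p.δ * (1 - p.δ) * quad g p (w k - t k) :=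
      mul_nonneg (mul_nonneg hs.delta_pos.le (sub_nonneg.2 hs.delta_le)) (hq0 _)
    simp only [he]
    linarith
  have hlim := fun u hu => tendsto_of_perturbed_decrease (V := fun k => quad g p (w k - u))
    (a := fun k => p.δ * c * quad g p (w k - t k)) (fun k => hq0 _)
    (fun k => mul_nonneg (mul_nonneg hs.delta_pos.le hc0.le) (hq0 _)) (hdec u hu) hes
  have hwt : Tendsto (fun k => t k - w k) atTop (𝓝 0) := by
    have h1 := (hlim v hv).2.const_mul (p.δ * c * τ)⁻¹
    rw [mul_zero] at h1
    have hd : 0 < p.δ * c * τ := mul_pos (mul_pos hs.delta_pos hc0) hs.tau_pos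
    have h2 : Tendsto (fun k => ‖t k - w k‖ ^ 2) atTop (𝓝 0) := by
      refine squeeze_zero (fun k => sq_nonneg _) (fun k => ?_) h1
      rw [le_inv_mul_iff₀ hd, norm_sub_rev]
      have := mul_le_mul_of_nonneg_left (le_quad hG hs (w k - t k))
        (mul_pos hs.delta_pos hc0).le
      linarith
    have h3 := h2.sqrt
    rw [tendsto_zero_iff_norm_tendsto_zero]
    simpa using h3
  have hε0 : Tendsto ε atTop (𝓝 0) := by
    have h3 := hε.tendsto_atTop_zero.sqrt
    rw [tendsto_zero_iff_norm_tendsto_zero]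
    simpa using h3
  have hdcl := domain_isClosed hcon
  have hFc : ContinuousOn (g.F P ξ) g.domain :=
    (LipschitzOnWith.of_dist_le_mul (K := ⟨ℓ, hF.ell_pos.le⟩) fun x hx y hy => by
      rw [dist_eq_norm, dist_eq_norm]
      exact hF.lipschitz x hx y hy).continuousOn
  -- A cluster point is a fixed point of the noise-free step: the errors and residuals vanish, and
  -- `𝔽` is continuous on the closed set `Ω`, which contains all iterates.
  refine tendsto_of_fejer (continuous_quad g p) (quad_zero g p) hs.tau_pos (le_quad hG hs)
    (Z := {u | IsZero g p P ξ u}) ⟨v, hv⟩ (fun u hu => (hlim u hu).1) fun φ y hφ hy => ?_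
  refine isZero_of_tilde_eq hcon hs ?_
  have hy1 : Tendsto (fun k => (w (φ k)).1) atTop (𝓝 y.1) :=
    (continuous_fst.tendsto y).comp hy
  have hyd : y.1 ∈ g.domain := hdcl.mem_of_tendsto hy1 (.of_forall fun k => hwd _)
  have hFy : Tendsto (fun k => g.F P ξ (w (φ k)).1) atTop (𝓝 (g.F P ξ y.1)) :=
    (hFc y.1 hyd).tendsto.comp
      (tendsto_nhdsWithin_iff.2 ⟨hy1, .of_forall fun k => hwd _⟩)
  have h1 : Tendsto (fun k => t (φ k)) atTop (𝓝 (tilde g p (g.F P ξ y.1) y)) := by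
    have h2 := (hFy.add (hε0.comp hφ.tendsto_atTop)).prodMk_nhds hy
    rw [add_zero] at h2
    have h3 := ((continuous_tilde (p := p) hcon).tendsto (g.F P ξ y.1, y)).comp h2
    exact h3
  have h2 : Tendsto (fun k => t (φ k)) atTop (𝓝 y) := by
    have h3 := (hwt.comp hφ.tendsto_atTop).add hy
    rw [zero_add] at h3
    exact h3.congr fun k => by simp
  exact tendsto_nhds_unique h1 h2

end operator

/-! ### Existence of a solution, a multiplier and a zero. -/

section existence

theorem exists_variational_solution {E : Type*} [NormedAddCommGroup E] [InnerProductSpace ℝ E]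
    {C : Set E} (hne : C.Nonempty) (hC : IsComplete C) (hcv : Convex ℝ C) {F : E → E} {η ℓ : ℝ}
    (hη : 0 < η) (hℓ : 0 < ℓ)
    (hmono : ∀ x ∈ C, ∀ y ∈ C, η * ‖x - y‖ ^ 2 ≤ inner ℝ (F x - F y) (x - y))
    (hlip : ∀ x ∈ C, ∀ y ∈ C, ‖F x - F y‖ ≤ ℓ * ‖x - y‖) :
    ∃ x ∈ C, ∀ y ∈ C, 0 ≤ inner ℝ (F x) (y - x) := by
  have : CompleteSpace C := hC.completeSpace_coe
  have : Nonempty C := hne.to_subtype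
  -- This step makes `γ²ℓ² = γη`, so the squared contraction factor `1 - 2γη + γ²ℓ²` is `1 - ηγ`.
  -- That number can be negative if `C` is a single point, hence the maximum with 0.
  set γ : ℝ := η / ℓ ^ 2 with hγ
  have hγ0 : 0 < γ := by positivity
  set r : ℝ := max 0 (1 - η * γ) with hr
  have hr1 : r < 1 := max_lt one_pos (by linarith [mul_pos hη hγ0])
  have hr0 : 0 ≤ r := le_max_left _ _
  let T : C → C := fun x => ⟨proj C (x - γ • F x), (proj_spec hne hC hcv _).1⟩
  obtain ⟨κ, hκ⟩ : ∃ κ : NNReal, (κ : ℝ) = √r :=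
    ⟨(√r).toNNReal, Real.coe_toNNReal _ (Real.sqrt_nonneg r)⟩
  have hT : ContractingWith κ T := by
    refine ⟨?_, LipschitzWith.of_dist_le_mul fun x y => ?_⟩
    · rw [← NNReal.coe_lt_coe]
      rw [hκ]
      exact (Real.sqrt_lt' one_pos).2 (by simpa using hr1)
    · rw [Subtype.dist_eq, Subtype.dist_eq, dist_eq_norm, dist_eq_norm]
      refine (norm_proj_sub_proj_le hne hC hcv _ _).trans ?_
      rw [hκ]
      refine abs_le_of_sq_le_sq' ?_ (by positivity) |>.2
      rw [mul_pow, Real.sq_sqrt hr0]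
      have h1 := hmono x x.2 y y.2
      have h2 := pow_le_pow_left₀ (norm_nonneg _) (hlip x x.2 y y.2) 2
      have e : (x : E) - γ • F x - (y - γ • F y) = (x - y : E) - γ • (F x - F y) := by
        rw [smul_sub]; abel
      rw [e, norm_sub_sq_real, norm_smul, mul_pow, Real.norm_eq_abs, sq_abs,
        real_inner_smul_right, real_inner_comm]
      have h3 : γ ^ 2 * ‖F x - F y‖ ^ 2 ≤ γ * η * ‖(x - y : E)‖ ^ 2 := by
        have h4 := mul_le_mul_of_nonneg_left h2 (sq_nonneg γ)
        have h5 : γ ^ 2 * (ℓ * ‖(x - y : E)‖) ^ 2 = γ * η * ‖(x - y : E)‖ ^ 2 := by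
          rw [hγ]; field_simp
        linarith
      have h6 := mul_le_mul_of_nonneg_left h1 hγ0.le
      have h7 := mul_le_mul_of_nonneg_right (le_max_right 0 (1 - η * γ))
        (sq_nonneg ‖(x - y : E)‖)
      linarith
  obtain ⟨x, hx⟩ : ∃ x : C, T x = x := ⟨_, hT.fixedPoint_isFixedPt⟩
  refine ⟨x, x.2, fun y hy => ?_⟩
  have h := (proj_spec hne hC hcv ((x : E) - γ • F x)).2 y hy
  have hx' : proj C ((x : E) - γ • F x) = x := congrArg Subtype.val hx
  rw [hx', sub_sub_cancel_left, inner_neg_left, real_inner_smul_left] at h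
  exact nonneg_of_mul_nonneg_right (by linarith) hγ0

/-- Optimality makes the open negative cone `K` disjoint from the convex set `D` of objective and
constraint values. A separating functional has nonnegative coefficients; Slater's point forces the
one on the objective to be positive, and dividing by it gives the multiplier. -/
theorem exists_multiplier {E : Type*} [AddCommGroup E] [Module ℝ E] {m : ℕ} {C : Set E}
    (hcv : Convex ℝ C) (φ : E →ₗ[ℝ] ℝ) (T : E →ₗ[ℝ] Vec m) (b : Vec m) (c : ℝ)
    (hslater : ∃ x ∈ C, ∀ j, T x j < b j) (hmin : ∀ x ∈ C, (∀ j, T x j ≤ b j) → c ≤ φ x) :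
    ∃ l ∈ orthant m, ∀ x ∈ C, c ≤ φ x + inner ℝ (T x - b) l := by
  set K : Set (ℝ × (Fin m → ℝ)) := {q | q.1 < 0 ∧ ∀ j, q.2 j < 0} with hK
  set D : Set (ℝ × (Fin m → ℝ)) := (fun x => (φ x - c, fun j => T x j - b j)) '' C with hD
  have hKo : IsOpen K := by
    have : K = {q | q.1 < 0} ∩ ⋂ j, {q | q.2 j < 0} := by ext; simp [hK]
    rw [this]
    exact (isOpen_lt (by fun_prop) continuous_const).inter
      (isOpen_iInter_of_finite fun j => isOpen_lt (by fun_prop) continuous_const)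
  have hKc : Convex ℝ K := by
    refine (convex_iff_forall_pos.2 ?_)
    intro u hu v hv a b ha hb _
    refine ⟨?_, fun j => ?_⟩
    · have h1 := mul_neg_of_pos_of_neg ha hu.1
      have h2 := mul_neg_of_pos_of_neg hb hv.1
      simpa using add_neg h1 h2
    · have h1 := mul_neg_of_pos_of_neg ha (hu.2 j)
      have h2 := mul_neg_of_pos_of_neg hb (hv.2 j)
      simpa using add_neg h1 h2
  have hDc : Convex ℝ D := by
    rintro _ ⟨x, hx, rfl⟩ _ ⟨y, hy, rfl⟩ s t hs ht hst
    refine ⟨s • x + t • y, hcv hx hy hs ht hst, ?_⟩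
    have e : ∀ d : ℝ, d = s * d + t * d := fun d => by rw [← add_mul, hst, one_mul]
    refine Prod.ext ?_ (funext fun j => ?_)
    · simp only [map_add, map_smul, smul_eq_mul, Prod.fst_add, Prod.smul_fst]
      linarith [e c]
    · simp only [map_add, map_smul, smul_eq_mul, Prod.snd_add, Prod.smul_snd, PiLp.add_apply,
        PiLp.smul_apply, Pi.add_apply, Pi.smul_apply]
      linarith [e (b j)]
  have hdisj : Disjoint K D := by
    rw [Set.disjoint_left]
    rintro _ hq ⟨x, hx, rfl⟩
    have h1 : φ x - c < 0 := hq.1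
    have h2 : ∀ j, T x j - b j < 0 := hq.2
    linarith [hmin x hx fun j => by linarith [h2 j]]
  obtain ⟨f, s, hf, hs⟩ := geometric_hahn_banach_open hKc hKo hDc hdisj
  set a : ℝ × (Fin m → ℝ) := (-1, fun _ => -1) with ha
  -- Such `q` are recession directions of `K`, on which `f` is bounded above by `s`.
  have hneg : ∀ q : ℝ × (Fin m → ℝ), q.1 ≤ 0 → (∀ j, q.2 j ≤ 0) → f q ≤ 0 := by
    intro q hq1 hq2
    by_contra! h
    have h1 : ∀ t : ℝ, 0 ≤ t → t * f q + f a < s := fun t ht => by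
      rw [← smul_eq_mul, ← map_smul, ← map_add]
      refine hf _ ⟨?_, fun j => ?_⟩
      · have := mul_nonpos_of_nonneg_of_nonpos ht hq1
        change t * q.1 + -1 < 0
        linarith
      · have := mul_nonpos_of_nonneg_of_nonpos ht (hq2 j)
        change t * q.2 j + -1 < 0
        linarith
    have h2 := h1 (|s - f a| / f q) (by positivity)
    rw [div_mul_cancel₀ _ h.ne'] at h2
    linarith [le_abs_self (s - f a)]
  have hs0 : 0 ≤ s := by
    by_contra! h
    have h1 : f a < s := hf a ⟨by simp [ha], fun j => by simp [ha]⟩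
    have h2 : f ((s / f a) • a) < s := by
      have : 0 < s / f a := div_pos_of_neg_of_neg h (by linarith)
      exact hf _ ⟨by simpa [ha] using this, fun j => by simpa [ha] using this⟩
    rw [map_smul, smul_eq_mul, div_mul_cancel₀ _ (by linarith)] at h2
    exact lt_irrefl _ h2
  have hrep : ∀ q : ℝ × (Fin m → ℝ), f q = q.1 * f (1, 0) + ∑ j, q.2 j * f (0, Pi.single j 1) := by
    intro q
    have e : q = q.1 • ((1 : ℝ), (0 : Fin m → ℝ))
        + ∑ j, q.2 j • ((0 : ℝ), (Pi.single j 1 : Fin m → ℝ)) := by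
      refine Prod.ext ?_ (funext fun i => ?_)
      · simp [Prod.fst_sum]
      · simp [Prod.snd_sum, Finset.sum_apply, Pi.single_apply]
    conv_lhs => rw [e]
    simp only [map_add, map_sum, map_smul, smul_eq_mul]
  set μ := f (1, 0) with hμ
  set l : Fin m → ℝ := fun j => f (0, Pi.single j 1) with hl
  have hμ0 : 0 ≤ μ := by
    have h := hneg (-(1, 0)) (by simp) (by simp)
    rw [map_neg] at h
    linarith
  have hl0 : ∀ j, 0 ≤ l j := fun j => by
    have h := hneg (-(0, Pi.single j 1)) (by simp) (fun i => by
      simp only [Prod.snd_neg, Pi.neg_apply, Left.neg_nonpos_iff]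
      exact (Pi.single_nonneg.2 zero_le_one : (0 : Fin m → ℝ) ≤ Pi.single j 1) i)
    rw [map_neg] at h
    simp only [hl]
    linarith
  have hD' : ∀ x ∈ C, s ≤ (φ x - c) * μ + ∑ j, (T x j - b j) * l j := fun x hx => by
    have h := hs _ ⟨x, hx, rfl⟩
    rwa [hrep] at h
  have hμpos : 0 < μ := by
    refine lt_of_le_of_ne hμ0 fun h0 => ?_
    obtain ⟨x, hx, hlt⟩ := hslater
    have h1 := hD' x hx
    rw [← h0, mul_zero, zero_add] at h1
    have hterm : ∀ j ∈ Finset.univ, (T x j - b j) * l j ≤ 0 := fun j _ =>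
      mul_nonpos_of_nonpos_of_nonneg (by linarith [hlt j]) (hl0 j)
    have h2 : ∑ j, (T x j - b j) * l j = 0 :=
      le_antisymm (Finset.sum_nonpos hterm) (hs0.trans h1)
    have h3 : ∀ j, l j = 0 := fun j => by
      have := (Finset.sum_eq_zero_iff_of_nonpos hterm).1 h2 j (Finset.mem_univ j)
      exact (mul_eq_zero.1 this).resolve_left (by linarith [hlt j])
    have h4 : f a < s := hf a ⟨by simp [ha], fun j => by simp [ha]⟩
    rw [hrep, ← h0] at h4
    have h5 : ∑ j, a.2 j * l j = 0 := Finset.sum_eq_zero fun j _ => by rw [h3, mul_zero]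
    linarith
  refine ⟨WithLp.toLp 2 fun j => l j / μ, fun j => div_nonneg (hl0 j) hμ0, fun x hx => ?_⟩
  have h1 := hs0.trans (hD' x hx)
  have h2 : inner ℝ (T x - b) (WithLp.toLp 2 fun j => l j / μ)
      = (∑ j, (T x j - b j) * l j) / μ := by
    rw [inner_vec, Finset.sum_div]
    exact Finset.sum_congr rfl fun j _ => by simp [mul_div_assoc]
  have h3 : 0 ≤ ((φ x - c) * μ + ∑ j, (T x j - b j) * l j) / μ := div_nonneg h1 hμ0
  rw [add_div, mul_div_cancel_right₀ _ hμpos.ne'] at h3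
  rw [h2]
  linarith

variable {N : ℕ} {n : Fin N → ℕ} {m : ℕ}

@[simp] theorem deviate_same (x : Strat n) (i : Fin N) (y : Vec (n i)) : deviate x i y i = y := by
  simp [deviate]

theorem deviate_ne (x : Strat n) {i j : Fin N} (h : j ≠ i) (y : Vec (n i)) :
    deviate x i y j = x j := by
  simp [deviate, h]

@[simp] theorem deviate_self (x : Strat n) (i : Fin N) : deviate x i (x i) = x := by
  simp [deviate]

theorem inner_deviate_sub (u x : Strat n) (i : Fin N) (y : Vec (n i)) :
    inner ℝ u (deviate x i y - x) = inner ℝ (u i) (y - x i) := by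
  rw [inner_strat, Finset.sum_eq_single i]
  · simp
  · intro j _ hj
    simp [deviate_ne x hj y]
  · simp

variable {S : Type*} {g : Game N n m S}

theorem deviate_mem_domain {x : Strat n} (hx : x ∈ g.domain) {i : Fin N} {y : Vec (n i)}
    (hy : y ∈ g.dom i) : deviate x i y ∈ g.domain := fun j => by
  by_cases h : j = i
  · subst h
    simpa using hy
  · rw [deviate_ne x h]
    exact hx j

theorem deviate_mem_feasible {x : Strat n} (hx : x ∈ g.domain) {i : Fin N} {y : Vec (n i)}
    (hy : y ∈ g.feasibleAt i x) : deviate x i y ∈ g.feasible := by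
  refine ⟨deviate_mem_domain hx hy.1, fun r => ?_⟩
  have h := hy.2 r
  have e : g.Ax (deviate x i y) = mulV (g.A i) y
      + ∑ j ∈ Finset.univ.erase i, mulV (g.A j) (x j) := by
    rw [Game.Ax, ← Finset.add_sum_erase _ _ (Finset.mem_univ i), deviate_same]
    congr 1
    exact Finset.sum_congr rfl fun j hj => by rw [deviate_ne x (Finset.ne_of_mem_erase hj)]
  rw [e, PiLp.add_apply]
  rw [PiLp.sub_apply] at h
  linarith

/-- `x ↦ A x` as a linear map. -/
def Game.axMap (g : Game N n m S) : Strat n →ₗ[ℝ] Vec m where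
  toFun := g.Ax
  map_add' x y := by simp [Game.Ax, mulV_add, Finset.sum_add_distrib]
  map_smul' c x := by simp [Game.Ax, mulV_smul, Finset.smul_sum]

theorem domain_convex (hcon : g.ConstraintAssumptions) : Convex ℝ g.domain :=
  fun _ hx _ hy _ _ ha hb hab i => hcon.convex i (hx i) (hy i) ha hb hab

theorem feasible_convex (hcon : g.ConstraintAssumptions) : Convex ℝ g.feasible := by
  intro x hx y hy a b ha hb hab
  refine ⟨domain_convex hcon hx.1 hy.1 ha hb hab, fun j => ?_⟩
  have e : g.Ax (a • x + b • y) = a • g.Ax x + b • g.Ax y := by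
    change g.axMap _ = a • g.axMap x + b • g.axMap y
    rw [map_add, map_smul, map_smul]
  rw [e]
  have h1 := mul_le_mul_of_nonneg_left (hx.2 j) ha
  have h2 := mul_le_mul_of_nonneg_left (hy.2 j) hb
  have h3 : g.b j = a * g.b j + b * g.b j := by rw [← add_mul, hab, one_mul]
  simp only [PiLp.add_apply, PiLp.smul_apply, smul_eq_mul]
  linarith

theorem feasible_isClosed (hcon : g.ConstraintAssumptions) : IsClosed g.feasible := by
  have hc : Continuous g.Ax := g.axMap.continuous_of_finiteDimensional
  have : g.feasible = g.domain ∩ ⋂ j, {x : Strat n | g.Ax x j ≤ g.b j} := by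
    ext x; simp [Game.feasible]
  rw [this]
  exact (domain_isClosed hcon).inter (isClosed_iInter fun j =>
    isClosed_le ((PiLp.continuous_apply 2 _ j).comp hc) continuous_const)

variable {Ξ : Type*} [MeasurableSpace Ξ] {P : Measure Ξ} {ξ : Ξ → S} {η ℓ : ℝ}

theorem exists_isSVISolution (hcon : g.ConstraintAssumptions)
    (hF : g.PseudoGradientAssumptions P ξ η ℓ) : ∃ x, g.IsSVISolution P ξ x := by
  obtain ⟨x₀, hx₀, hlt⟩ := hcon.slater
  have hne : g.feasible.Nonempty := ⟨x₀, hx₀, fun j => (hlt j).le⟩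
  exact exists_variational_solution hne
    (feasible_isClosed hcon).isComplete (feasible_convex hcon) hF.eta_pos hF.ell_pos
    (fun x hx y hy => hF.stronglyMonotone x hx.1 y hy.1)
    (fun x hx y hy => hF.lipschitz x hx.1 y hy.1)

variable {p : Params N m} {G : SimpleGraph (Fin N)}

theorem exists_isZero (hcon : g.ConstraintAssumptions) (hb : ∑ i, p.b i = g.b)
    (hG : DualGraph G p.W) {x : Strat n} (hx : g.IsSVISolution P ξ x) :
    ∃ w, IsZero g p P ξ w ∧ w.1 = x := by
  obtain ⟨hxf, hvi⟩ := hx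
  obtain ⟨i₀⟩ := hG.connected.nonempty
  have hN : (N : ℝ) ≠ 0 := Nat.cast_ne_zero.2 (Nat.ne_of_gt i₀.pos)
  obtain ⟨l, hl, hmul⟩ := exists_multiplier (domain_convex hcon)
    (innerₗ (Strat n) (g.F P ξ x)) g.axMap g.b (inner ℝ (g.F P ξ x) x) hcon.slater
    (fun y hy hle => by
      have h := hvi y ⟨hy, hle⟩
      rw [inner_sub_right] at h
      simpa using h)
  simp only [innerₗ_apply_apply] at hmul
  change ∀ y ∈ g.domain, inner ℝ (g.F P ξ x) x ≤ inner ℝ (g.F P ξ x) y + inner ℝ (g.Ax y - g.b) l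
    at hmul
  have hcomp : inner ℝ (g.Ax x - g.b) l = 0 := by
    refine le_antisymm ?_ (by linarith [hmul x hxf.1])
    rw [inner_vec]
    exact Finset.sum_nonpos fun j _ => mul_nonpos_of_nonpos_of_nonneg
      (by simpa using hxf.2 j) (hl j)
  -- With this `z` each player's dual residual becomes the equal share `(A x - b) / N`, so each dual
  -- condition follows from feasibility and complementarity.
  obtain ⟨z, hz⟩ := exists_lapMap_eq hG hG.nonneg
    (v := WithLp.toLp 2 fun i => (N : ℝ)⁻¹ • (g.Ax x - g.b) - (mulV (g.A i) (x i) - p.b i)) (by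
      change ∑ i, ((N : ℝ)⁻¹ • (g.Ax x - g.b) - (mulV (g.A i) (x i) - p.b i)) = 0
      rw [Finset.sum_sub_distrib, Finset.sum_sub_distrib, hb, Finset.sum_const, Finset.card_univ,
        Fintype.card_fin, ← Nat.cast_smul_eq_nsmul ℝ, smul_inv_smul₀ hN]
      exact sub_self _)
  refine ⟨(x, z.ofLp, fun _ => l), ⟨hxf.1, fun i y hy => ?_, ?_, fun _ => hl, fun i μ hμ => ?_⟩,
    rfl⟩
  · have h := hmul _ (deviate_mem_domain hxf.1 hy)
    have e : g.Ax (deviate x i y) - g.Ax x = mulV (g.A i) (y - x i) := by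
      rw [Game.Ax, Game.Ax, ← Finset.sum_sub_distrib, Finset.sum_eq_single i]
      · rw [deviate_same, mulV_sub]
      · intro j _ hj
        rw [deviate_ne x hj, sub_self]
      · simp
    have h2 := inner_deviate_sub (g.F P ξ x) x i y
    have h3 : inner ℝ (g.Ax (deviate x i y) - g.b) l
        = inner ℝ (mulV (g.A i) (y - x i)) l + inner ℝ (g.Ax x - g.b) l := by
      rw [← inner_add_left, ← e, sub_add_sub_cancel]
    rw [inner_add_left, inner_mulV_transpose, ← h2, inner_sub_right]
    linarith
  · exact PiLp.ext fun i => by simp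
  · have e : (WithLp.toLp 2 z.ofLp : Strat fun _ : Fin N => m) = z := rfl
    simp only [e, hz]
    rw [add_sub_cancel, real_inner_smul_left, inner_sub_right, hcomp, sub_zero, inner_vec]
    exact mul_nonpos_of_nonneg_of_nonpos (by positivity) (Finset.sum_nonpos fun j _ =>
      mul_nonpos_of_nonpos_of_nonneg (by simpa using hxf.2 j) (hμ j))

end existence

/-! ### Sampled gradients: measurability, integrability, unbiasedness, and equilibria from the
variational inequality. -/

section gradients

section batchMean

variable {N : ℕ} {n : Fin N → ℕ} {m : ℕ} {S : Type*}

/-- The sample average as a function of one batch of samples. -/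
def batchMean (g : Game N n m S) {B : ℕ} (z : Fin N → Fin B → S) (x : Strat n) : Strat n :=
  WithLp.toLp 2 (fun i => (B : ℝ)⁻¹ • ∑ t, g.gradJ i x (z i t))

theorem saa_eq_batchMean (g : Game N n m S) (B : ℕ) (samp : Fin N → ℕ → S) (x : Strat n) :
    saa g B samp x = batchMean g (fun i (t : Fin B) => samp i t) x := by
  simp only [saa, batchMean, Finset.sum_range]

end batchMean

variable {N : ℕ} {n : Fin N → ℕ} {m : ℕ} {S : Type*} [MeasurableSpace S] {g : Game N n m S}
  {Ξ : Type*} [MeasurableSpace Ξ] {P : Measure Ξ} {ξ : Ξ → S}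

theorem hasGradientAt_gradJ (hcost : g.CostAssumptions P ξ) (i : Fin N) (x : Strat n) (s : S) :
    HasGradientAt (fun y => g.J i (deviate x i y) s) (g.gradJ i x s) (x i) :=
  ((hcost.contDiff i x s).differentiable one_ne_zero _).hasGradientAt

theorem hasDerivAt_deviate (hcost : g.CostAssumptions P ξ) (i : Fin N) (x : Strat n) (s : S)
    (v : Vec (n i)) :
    HasDerivAt (fun t : ℝ => g.J i (deviate x i (x i + t • v)) s)
      (inner ℝ (g.gradJ i x s) v) 0 := by
  have h1 := (hasGradientAt_gradJ hcost i x s).hasFDerivAt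
  have h2 : HasDerivAt (fun t : ℝ => x i + t • v) v 0 := by
    simpa using ((hasDerivAt_id (0 : ℝ)).smul_const v).const_add (x i)
  have h3 : x i = x i + (0 : ℝ) • v := by simp
  rw [h3] at h1
  have h4 := h1.comp_hasDerivAt (0 : ℝ) h2
  rw [InnerProductSpace.toDual_apply_apply] at h4
  exact h4

theorem gradJ_inequality (hcost : g.CostAssumptions P ξ) (i : Fin N) (x : Strat n) (s : S)
    (y : Vec (n i)) :
    g.J i x s + inner ℝ (g.gradJ i x s) (y - x i) ≤ g.J i (deviate x i y) s := by
  have hc : ConvexOn ℝ Set.univ fun t : ℝ => g.J i (deviate x i (x i + t • (y - x i))) s := by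
    refine ⟨convex_univ, fun t _ u _ a b ha hb hab => ?_⟩
    have e : x i + (a • t + b • u) • (y - x i)
        = a • (x i + t • (y - x i)) + b • (x i + u • (y - x i)) := by
      have : x i = a • x i + b • x i := by rw [← add_smul, hab, one_smul]
      simp only [smul_eq_mul, add_smul, mul_smul, smul_add]
      nth_rw 1 [this]
      abel
    beta_reduce
    rw [e]
    exact (hcost.convex i x s).2 (Set.mem_univ _) (Set.mem_univ _) ha hb hab
  have h := hc.le_slope_of_hasDerivAt (Set.mem_univ _) (Set.mem_univ _) one_pos
    (hasDerivAt_deviate hcost i x s (y - x i))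
  simp only [slope_def_field, zero_smul, add_zero, one_smul, deviate_self, sub_zero, div_one,
    add_sub_cancel] at h
  linarith

theorem continuous_deviate (i : Fin N) (v : Vec (n i)) :
    Continuous fun x : Strat n => deviate x i (x i + v) := by
  unfold deviate
  refine (PiLp.continuous_toLp 2 _).comp (Continuous.update ?_ i ?_)
  · exact PiLp.continuous_ofLp 2 _
  · fun_prop

/-- Each coordinate is a pointwise limit of difference quotients with increments `1 / (k + 1)`, and
these inherit joint measurability from `J`. -/
theorem measurable_gradJ (hcost : g.CostAssumptions P ξ) (i : Fin N) :
    Measurable fun q : Strat n × S => g.gradJ i q.1 q.2 := by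
  have hcoord : ∀ j, Measurable fun q : Strat n × S => g.gradJ i q.1 q.2 j := by
    intro j
    set e : Vec (n i) := EuclideanSpace.single j 1
    have hd : ∀ c : ℝ, Measurable fun q : Strat n × S =>
        g.J i (deviate q.1 i (q.1 i + c • e)) q.2 := fun c =>
      (hcost.measurable i).comp
        (((continuous_deviate i (c • e)).measurable.comp measurable_fst).prodMk measurable_snd)
    refine measurable_of_tendsto_metrizable
      (f := fun (k : ℕ) (q : Strat n × S) => (1 / ((k : ℝ) + 1))⁻¹ •
        (g.J i (deviate q.1 i (q.1 i + (0 + 1 / ((k : ℝ) + 1)) • e)) q.2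
          - g.J i (deviate q.1 i (q.1 i + (0 : ℝ) • e)) q.2))
      (fun k => ((hd (0 + 1 / ((k : ℝ) + 1))).sub (hd 0)).const_smul (1 / ((k : ℝ) + 1))⁻¹) ?_
    rw [tendsto_pi_nhds]
    intro q
    have h1 := hasDerivAt_iff_tendsto_slope_zero.1 (hasDerivAt_deviate hcost i q.1 q.2 e)
    have h2 : inner ℝ (g.gradJ i q.1 q.2) e = g.gradJ i q.1 q.2 j := by
      simp [e, EuclideanSpace.inner_single_right]
    rw [h2] at h1
    exact h1.comp (tendsto_nhdsWithin_iff.2 ⟨tendsto_one_div_add_atTop_nhds_zero_nat,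
      .of_forall fun k => by
        simp only [Set.mem_compl_iff, Set.mem_singleton_iff]
        positivity⟩)
  exact (WithLp.measurable_toLp 2 _).comp (measurable_pi_iff.2 hcoord)

/-- A Lipschitz constant on an open neighbourhood bounds the gradient at boundary points of `Ω_i`
too. -/
theorem exists_norm_gradJ_le (hcost : g.CostAssumptions P ξ) (i : Fin N) {x : Strat n}
    (hx : x ∈ g.domain) : ∃ K : S → NNReal, Integrable (fun ω => (K (ξ ω) : ℝ)) P ∧
      ∀ s, ‖g.gradJ i x s‖ ≤ K s := by
  obtain ⟨K, U, hK, hU, hsub, hlip⟩ := hcost.lipschitz i x hx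
  refine ⟨K, hK, fun s => ?_⟩
  have h := (hasGradientAt_gradJ hcost i x s).hasFDerivAt.le_of_lipschitzOn
    (hU.mem_nhds (hsub (hx i))) (hlip s)
  rwa [LinearIsometryEquiv.norm_map] at h

theorem integrable_gradJ (hξ : Measurable ξ) (hcost : g.CostAssumptions P ξ) (i : Fin N)
    {x : Strat n} (hx : x ∈ g.domain) : Integrable (fun ω => g.gradJ i x (ξ ω)) P := by
  obtain ⟨K, hK, hle⟩ := exists_norm_gradJ_le hcost i hx
  refine hK.mono' ?_ (.of_forall fun ω => hle _)
  exact ((measurable_gradJ hcost i).comp (measurable_const.prodMk hξ)).aestronglyMeasurable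

/-- The expectation of the convex gradient inequality suffices; gradient and expectation need not be
interchanged. -/
theorem isVGNE_of_isSVISolution (hξ : Measurable ξ) (hcost : g.CostAssumptions P ξ)
    {x : Strat n} (hx : g.IsSVISolution P ξ x) : g.IsVGNE P ξ x := by
  refine ⟨⟨hx.1, fun i y hy => ?_⟩, hx⟩
  have hyf := deviate_mem_feasible hx.1.1 hy
  have h1 := hx.2 _ hyf
  rw [inner_deviate_sub] at h1
  have hi := integrable_gradJ hξ hcost i hx.1.1
  have h2 : g.cost P ξ i x + inner ℝ (g.F P ξ x i) (y - x i) ≤ g.cost P ξ i (deviate x i y) := by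
    have e : inner ℝ (g.F P ξ x i) (y - x i)
        = ∫ ω, inner ℝ (g.gradJ i x (ξ ω)) (y - x i) ∂P := by
      simp only [real_inner_comm (y - x i)]
      exact (integral_inner hi (y - x i)).symm
    rw [e, Game.cost, Game.cost, ← integral_add (hcost.integrable i x hx.1)
      (hi.inner_const (y - x i))]
    exact integral_mono ((hcost.integrable i x hx.1).add (hi.inner_const (y - x i)))
      (hcost.integrable i _ hyf) fun ω => gradJ_inequality hcost i x (ξ ω) y
  linarith

theorem measurable_F [IsFiniteMeasure P] (hξ : Measurable ξ) (hcost : g.CostAssumptions P ξ) :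
    Measurable (g.F P ξ) := by
  refine (WithLp.measurable_toLp 2 _).comp (measurable_pi_iff.2 fun i => ?_)
  have h : Measurable fun q : Strat n × Ξ => g.gradJ i q.1 (ξ q.2) :=
    (measurable_gradJ hcost i).comp (measurable_fst.prodMk (hξ.comp measurable_snd))
  exact (h.stronglyMeasurable.integral_prod_right' (ν := P)).measurable

theorem measurable_batchMean (hcost : g.CostAssumptions P ξ) (B : ℕ) :
    Measurable fun q : (Fin N → Fin B → S) × Strat n => batchMean g q.1 q.2 := by
  refine (WithLp.measurable_toLp 2 _).comp (measurable_pi_iff.2 fun i => ?_)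
  have h : Measurable fun q : (Fin N → Fin B → S) × Strat n =>
      ∑ t, g.gradJ i q.2 (q.1 i t) := by
    refine Finset.measurable_fun_sum _ fun t _ => ?_
    have h1 : Measurable fun q : (Fin N → Fin B → S) × Strat n => q.1 i t := by fun_prop
    exact (measurable_gradJ hcost i).comp (measurable_snd.prodMk h1)
  exact h.const_smul (B : ℝ)⁻¹

/-- Unbiasedness at a frozen `x`, by linearity and equality of laws. An empty batch is excluded
because its mean would be zero. -/
theorem integral_inner_batchMean_sub_eq_zero (hξ : Measurable ξ) (hcost : g.CostAssumptions P ξ)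
    [IsProbabilityMeasure P] {B : ℕ} (hB : B ≠ 0) {z : Fin N → Fin B → Ξ → S}
    (hz : ∀ i t, IdentDistrib (z i t) ξ P P) {x : Strat n} (hx : x ∈ g.domain) (u : Strat n) :
    ∫ ω, inner ℝ (batchMean g (fun i t => z i t ω) x - g.F P ξ x) u ∂P = 0 := by
  have hid : ∀ i t, IdentDistrib (fun ω => inner ℝ (g.gradJ i x (z i t ω)) (u i))
      (fun ω => inner ℝ (g.gradJ i x (ξ ω)) (u i)) P P := fun i t =>
    (hz i t).comp (u := fun s => inner ℝ (g.gradJ i x s) (u i))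
      (((measurable_gradJ hcost i).comp (measurable_const.prodMk measurable_id)).inner_const)
  have hi : ∀ i t, Integrable (fun ω => inner ℝ (g.gradJ i x (z i t ω)) (u i)) P := fun i t =>
    (hid i t).integrable_iff.2 ((integrable_gradJ hξ hcost i hx).inner_const (u i))
  have hval : ∀ i t, ∫ ω, inner ℝ (g.gradJ i x (z i t ω)) (u i) ∂P
      = inner ℝ (g.F P ξ x i) (u i) := fun i t => by
    rw [(hid i t).integral_eq]
    simp only [real_inner_comm (u i)]
    exact integral_inner (integrable_gradJ hξ hcost i hx) (u i)
  have e : ∀ ω, inner ℝ (batchMean g (fun i t => z i t ω) x - g.F P ξ x) u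
      = ∑ i, ((B : ℝ)⁻¹ * ∑ t, inner ℝ (g.gradJ i x (z i t ω)) (u i)
        - inner ℝ (g.F P ξ x i) (u i)) := fun ω => by
    rw [inner_strat]
    refine Finset.sum_congr rfl fun i _ => ?_
    rw [PiLp.sub_apply, inner_sub_left, ← sum_inner, ← real_inner_smul_left]
    rfl
  have hsum : ∀ i, Integrable (fun ω => ∑ t, inner ℝ (g.gradJ i x (z i t ω)) (u i)) P :=
    fun i => integrable_finsetSum _ fun t _ => hi i t
  simp only [e]
  have hterm : ∀ i, Integrable (fun ω => (B : ℝ)⁻¹ * ∑ t, inner ℝ (g.gradJ i x (z i t ω)) (u i)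
      - inner ℝ (g.F P ξ x i) (u i)) P := fun i =>
    ((hsum i).const_mul _).sub (integrable_const _)
  rw [integral_finsetSum _ fun i _ => hterm i]
  refine Finset.sum_eq_zero fun i _ => ?_
  rw [integral_sub ((hsum i).const_mul _) (integrable_const _), integral_const_mul,
    integral_finsetSum _ fun t _ => hi i t]
  simp only [hval, Finset.sum_const, Finset.card_univ, Fintype.card_fin, nsmul_eq_mul,
    integral_const, probReal_univ, one_smul]
  rw [inv_mul_cancel_left₀ (Nat.cast_ne_zero.2 hB), sub_self]

end gradients

/-! ### Freezing under independence, summability, and martingale convergence. -/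

section probability

/-- Independence turns the joint law into a product, and Fubini integrates over `Z` first with `Y`
frozen. -/
theorem integral_eq_zero_of_indep {Ω α β : Type*} [MeasurableSpace α] [MeasurableSpace β]
    {m₁ m₂ mΩ : MeasurableSpace Ω} {P : Measure Ω} [IsProbabilityMeasure P]
    (hm₁ : m₁ ≤ mΩ) (hm₂ : m₂ ≤ mΩ) (hind : Indep m₁ m₂ P) {Y : Ω → α} {Z : Ω → β} (hY : Measurable[m₁] Y)
    (hZ : Measurable[m₂] Z) {H : α × β → ℝ} (hH : Measurable H)
    (hint : Integrable (fun ω => H (Y ω, Z ω)) P) (h0 : ∀ ω', ∫ ω, H (Y ω', Z ω) ∂P = 0) :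
    ∫ ω, H (Y ω, Z ω) ∂P = 0 := by
  have hY' : Measurable Y := hY.mono hm₁ le_rfl
  have hZ' : Measurable Z := hZ.mono hm₂ le_rfl
  have hYZ : IndepFun Y Z P :=
    indep_of_indep_of_le_left (indep_of_indep_of_le_right hind hZ.comap_le) hY.comap_le
  have hprod := (indepFun_iff_map_prod_eq_prod_map_map hY'.aemeasurable hZ'.aemeasurable).1 hYZ
  have : IsProbabilityMeasure (P.map Y) := Measure.isProbabilityMeasure_map hY'.aemeasurable
  have : IsProbabilityMeasure (P.map Z) := Measure.isProbabilityMeasure_map hZ'.aemeasurable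
  have hp : AEMeasurable (fun ω => (Y ω, Z ω)) P := (hY'.prodMk hZ').aemeasurable
  have hint' : Integrable H ((P.map Y).prod (P.map Z)) := by
    rw [← hprod]
    exact (integrable_map_measure hH.aestronglyMeasurable hp).2 hint
  rw [← integral_map hp hH.aestronglyMeasurable, hprod, integral_prod _ hint',
    integral_map hY'.aemeasurable hint'.integral_prod_left.aestronglyMeasurable]
  refine integral_eq_zero_of_ae (.of_forall fun ω' => ?_)
  have hHω : Measurable fun z => H (Y ω', z) := hH.comp (measurable_const.prodMk measurable_id)
  exact (integral_map hZ'.aemeasurable hHω.aestronglyMeasurable).trans (h0 ω')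

variable {Ω : Type*} {mΩ : MeasurableSpace Ω} {P : Measure Ω}

theorem ae_summable_of_summable_integral {f : ℕ → Ω → ℝ} (hf : ∀ k, Integrable (f k) P)
    (hf0 : ∀ k ω, 0 ≤ f k ω) (hs : Summable fun k => ∫ ω, f k ω ∂P) :
    ∀ᵐ ω ∂P, Summable fun k => f k ω := by
  have hm : ∀ k, AEMeasurable (fun ω => ENNReal.ofReal (f k ω)) P := fun k =>
    (hf k).aemeasurable.ennreal_ofReal
  have h1 : ∫⁻ ω, ∑' k, ENNReal.ofReal (f k ω) ∂P ≠ ⊤ := by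
    rw [lintegral_tsum hm]
    have : ∀ k, ∫⁻ ω, ENNReal.ofReal (f k ω) ∂P = ENNReal.ofReal (∫ ω, f k ω ∂P) := fun k =>
      (ofReal_integral_eq_lintegral_ofReal (hf k) (.of_forall (hf0 k))).symm
    simp only [this]
    rw [← ENNReal.ofReal_tsum_of_nonneg (fun k => integral_nonneg (hf0 k)) hs]
    exact ENNReal.ofReal_ne_top
  filter_upwards [ae_lt_top' (AEMeasurable.tsum hm) h1] with ω hω
  have h2 := ENNReal.summable_toReal hω.ne
  refine h2.congr fun k => ?_
  rw [ENNReal.toReal_ofReal (hf0 k ω)]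

/-- Testing `horth` with indicators gives the martingale property, and testing it with `M K` itself
gives orthogonal increments. So second moments add up, `|t| ≤ 1 + t²` bounds the `L¹` norms, and
Doob's theorem applies. -/
theorem ae_exists_tendsto_sum_of_orthogonal [IsProbabilityMeasure P] (ℱ : Filtration ℕ mΩ)
    {d : ℕ → Ω → ℝ} (hd : ∀ k, Measurable[ℱ (k + 1)] (d k)) (h2 : ∀ k, MemLp (d k) 2 P)
    (horth : ∀ k (φ : Ω → ℝ), Measurable[ℱ k] φ → Integrable (fun ω => φ ω * d k ω) P →
      ∫ ω, φ ω * d k ω ∂P = 0)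
    (hs : Summable fun k => ∫ ω, d k ω ^ 2 ∂P) :
    ∀ᵐ ω ∂P, ∃ s, Tendsto (fun K => ∑ k ∈ Finset.range K, d k ω) atTop (𝓝 s) := by
  set M : ℕ → Ω → ℝ := fun K ω => ∑ k ∈ Finset.range K, d k ω with hM
  have hMs : ∀ K ω, M (K + 1) ω = M K ω + d K ω := fun K ω => Finset.sum_range_succ _ _
  have hMm : ∀ K, Measurable[ℱ K] (M K) := fun K =>
    Finset.measurable_fun_sum _ fun k hk =>
      (hd k).mono (ℱ.mono (Finset.mem_range.1 hk)) le_rfl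
  have hM2 : ∀ K, MemLp (M K) 2 P := fun K => memLp_finsetSum _ fun k _ => h2 k
  have hMi : ∀ K, Integrable (M K) P := fun K => (hM2 K).integrable one_le_two
  have hdi : ∀ k, Integrable (d k) P := fun k => (h2 k).integrable one_le_two
  have hmart : Martingale M ℱ P := by
    refine martingale_of_setIntegral_eq_succ (fun K => (hMm K).stronglyMeasurable) hMi
      fun K s hs => ?_
    have hs' : MeasurableSet s := ℱ.le K s hs
    have e : ∀ ω, s.indicator (fun _ => (1 : ℝ)) ω * d K ω = s.indicator (d K) ω := fun ω => by
      by_cases h : ω ∈ s <;> simp [h]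
    have h := horth K (s.indicator fun _ => 1) (measurable_const.indicator hs) (by
      simp only [e]
      exact (hdi K).indicator hs')
    simp only [e] at h
    rw [integral_indicator hs'] at h
    simp only [hMs]
    rw [integral_add (hMi K).integrableOn (hdi K).integrableOn, h, add_zero]
  have hsq : ∀ K, ∫ ω, M K ω ^ 2 ∂P = ∑ k ∈ Finset.range K, ∫ ω, d k ω ^ 2 ∂P := by
    intro K
    induction K with
    | zero => simp [hM]
    | succ K ih =>
      have hc : Integrable (fun ω => M K ω * d K ω) P := (hM2 K).integrable_mul (h2 K)
      have h := horth K (M K) (hMm K) hc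
      have e : ∀ ω, M (K + 1) ω ^ 2 = M K ω ^ 2 + 2 * (M K ω * d K ω) + d K ω ^ 2 := fun ω => by
        rw [hMs]; ring
      simp only [e]
      have hi : Integrable (fun ω => M K ω ^ 2 + 2 * (M K ω * d K ω)) P :=
        (hM2 K).integrable_sq.add (hc.const_mul 2)
      rw [integral_add hi (h2 K).integrable_sq,
        integral_add (hM2 K).integrable_sq (hc.const_mul 2), integral_const_mul, h, ih,
        Finset.sum_range_succ]
      ring
  set R : ℝ := 1 + ∑' k, ∫ ω, d k ω ^ 2 ∂P
  have hbound : ∀ K, eLpNorm (M K) 1 P ≤ (R.toNNReal : ENNReal) := fun K => by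
    rw [eLpNorm_one_eq_lintegral_enorm, ← ofReal_integral_norm_eq_lintegral_enorm (hMi K)]
    refine ENNReal.ofReal_le_ofReal ?_
    have h1 : ∫ ω, ‖M K ω‖ ∂P ≤ ∫ ω, (1 + M K ω ^ 2) ∂P := by
      refine integral_mono (hMi K).norm ((integrable_const _).add (hM2 K).integrable_sq)
        fun ω => ?_
      simp only [Real.norm_eq_abs]
      nlinarith [sq_abs (M K ω), sq_nonneg (|M K ω| - 1)]
    rw [integral_add (integrable_const _) (hM2 K).integrable_sq, hsq] at h1
    simp only [integral_const, probReal_univ, smul_eq_mul, mul_one] at h1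
    refine h1.trans (add_le_add le_rfl ?_)
    exact hs.sum_le_tsum _ fun k _ => integral_nonneg fun ω => sq_nonneg _
  filter_upwards [hmart.submartingale.ae_tendsto_limitProcess hbound] with ω hω
  exact ⟨_, hω⟩

end probability

theorem summable_inv_of_rpow_le {B : ℕ → ℕ} {c k₀ a : ℝ} (hc : 0 < c) (hk₀ : 0 < k₀) (ha : 0 < a)
    (hB : ∀ k : ℕ, c * ((k : ℝ) + k₀) ^ (a + 1) ≤ (B k : ℝ)) :
    Summable fun k => (B k : ℝ)⁻¹ := by
  have h := ((Real.summable_one_div_nat_add_rpow k₀ (a + 1)).2 (by linarith)).mul_left c⁻¹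
  refine Summable.of_nonneg_of_le (fun k => by positivity) (fun k => ?_) h
  have hp : 0 < (k : ℝ) + k₀ := by positivity
  rw [abs_of_pos hp, one_div, ← mul_inv]
  exact inv_anti₀ (by positivity) (hB k)

/-! ### The σ-algebras of the past and of a batch. -/

section sigma_algebras

variable {N : ℕ} {n : Fin N → ℕ} {m : ℕ} {S Ξ : Type*} [MeasurableSpace S]
  {B : ℕ → ℕ} {samp : ℕ → Fin N → ℕ → Ξ → S} {X0 : Ξ → State n m}

theorem pastσ_mono : Monotone (pastσ B samp X0) := fun _ _ hkl =>
  sup_le_sup le_rfl (iSup_le fun j =>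
    le_iSup (fun j : Fin _ => batchσ B samp j) (Fin.castLE hkl j))

theorem batchσ_le_pastσ_succ (k : ℕ) : batchσ B samp k ≤ pastσ B samp X0 (k + 1) :=
  le_sup_of_le_right (le_iSup (fun j : Fin (k + 1) => batchσ B samp j) (Fin.last k))

theorem measurable_batch (k : ℕ) :
    Measurable[batchσ B samp k] fun ω i (t : Fin (B k)) => samp k i t ω := by
  refine @measurable_pi_lambda _ _ _ (batchσ B samp k) _ _ fun i =>
    @measurable_pi_lambda _ _ _ (batchσ B samp k) _ _ fun t => ?_
  exact Measurable.mono (comap_measurable (samp k i t))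
    (le_iSup₂ (f := fun (i : Fin N) (t : Fin (B k)) =>
      MeasurableSpace.comap (samp k i t) inferInstance) i t) le_rfl

end sigma_algebras

/-! ### Boundedness and measurability of the iteration. -/

section iterates

variable {N : ℕ} {n : Fin N → ℕ} {m : ℕ} {S Ξ : Type*} {g : Game N n m S} {p : Params N m}
  {B : ℕ → ℕ} {samp : ℕ → Fin N → ℕ → Ξ → S} {X0 : Ξ → State n m}

theorem exists_norm_sub_le (hcon : g.ConstraintAssumptions) :
    ∃ R, ∀ x ∈ g.domain, ∀ y ∈ g.domain, ‖x - y‖ ≤ R := by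
  have hc : IsCompact g.domain := by
    have h := (isCompact_univ_pi hcon.compact).image (PiLp.continuous_toLp 2 _)
    convert h using 1
    ext x
    constructor
    · exact fun hx => ⟨x.ofLp, fun i _ => hx i, rfl⟩
    · rintro ⟨y, hy, rfl⟩ i
      exact hy i trivial
  obtain ⟨R, hR⟩ := hc.isBounded.exists_norm_le
  exact ⟨R + R, fun x hx y hy => (norm_sub_le x y).trans (add_le_add (hR x hx) (hR y hy))⟩

theorem iter_mem {η ℓ β τ : ℝ} (hcon : g.ConstraintAssumptions)
    (hs : StepAssumptions g p η ℓ β τ) (hX0 : ∀ ω, (X0 ω).1 ∈ g.domain) (k : ℕ) (ω : Ξ) :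
    (iter g p B samp X0 k ω).1 ∈ g.domain := by
  induction k with
  | zero => exact hX0 ω
  | succ k ih => exact step_mem hcon hs _ ih

theorem err_eq [MeasurableSpace Ξ] (P : Measure Ξ) (ξ : Ξ → S) (k : ℕ) (ω : Ξ) :
    err g p P ξ B samp X0 k ω = batchMean g (fun i (t : Fin (B k)) => samp k i t ω) (iter g p B samp X0 k ω).1
      - g.F P ξ (iter g p B samp X0 k ω).1 := by
  rw [err, saa_eq_batchMean]

theorem measurable_step (hcon : g.ConstraintAssumptions) :
    Measurable fun q : Strat n × State n m => step g p q.1 q.2 := by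
  have h : Continuous fun q : Strat n × State n m => step g p q.1 q.2 := by
    simp only [step_eq]
    exact (continuous_snd.const_smul (1 - p.δ)).add ((continuous_tilde hcon).const_smul p.δ)
  exact h.measurable

end iterates

/-! ### Adaptedness of the iterates and convergence of the noise series. -/

section stochastic

variable {N : ℕ} {n : Fin N → ℕ} {m : ℕ} {S Ξ : Type*} [MeasurableSpace S]
  [mΞ : MeasurableSpace Ξ] {P : Measure Ξ} {ξ : Ξ → S} {g : Game N n m S} {p : Params N m}
  {B : ℕ → ℕ} {samp : ℕ → Fin N → ℕ → Ξ → S} {X0 : Ξ → State n m}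

theorem batchσ_le (hsamp : IsSampling P ξ B samp X0) (k : ℕ) : batchσ B samp k ≤ mΞ :=
  iSup₂_le fun i t => (hsamp.measurable k i t).comap_le

theorem pastσ_le (hsamp : IsSampling P ξ B samp X0) (k : ℕ) : pastσ B samp X0 k ≤ mΞ :=
  sup_le hsamp.measurable_init.comap_le (iSup_le fun j => batchσ_le hsamp j)

/-- The filtration `(F_k)`. -/
def pastFiltration (hsamp : IsSampling P ξ B samp X0) : Filtration ℕ mΞ where
  seq := pastσ B samp X0
  mono' := pastσ_mono
  le' := pastσ_le hsamp

theorem measurable_iter (hcon : g.ConstraintAssumptions) (hcost : g.CostAssumptions P ξ) (k : ℕ) :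
    Measurable[pastσ B samp X0 k] (iter g p B samp X0 k) := by
  induction k with
  | zero => exact (comap_measurable X0).mono le_sup_left le_rfl
  | succ k ih =>
    have h1 := ih.mono (pastσ_mono (Nat.le_succ k)) le_rfl
    have h2 := (measurable_batch (B := B) (samp := samp) k).mono
      (batchσ_le_pastσ_succ (X0 := X0) k) le_rfl
    have h3 := (measurable_batchMean hcost (B k)).comp (h2.prodMk (measurable_fst.comp h1))
    have h4 := (measurable_step (p := p) hcon).comp (h3.prodMk h1)
    have e : iter g p B samp X0 (k + 1) = fun ω => step g p
        (batchMean g (fun i (t : Fin (B k)) => samp k i t ω) (iter g p B samp X0 k ω).1)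
        (iter g p B samp X0 k ω) := funext fun ω => by simp only [iter, saa_eq_batchMean]
    rw [e]
    exact h4

theorem measurable_err [IsFiniteMeasure P] (hξ : Measurable ξ) (hcon : g.ConstraintAssumptions)
    (hcost : g.CostAssumptions P ξ) (k : ℕ) :
    Measurable[pastσ B samp X0 (k + 1)] (err g p P ξ B samp X0 k) := by
  have h1 := measurable_fst.comp
    ((measurable_iter (p := p) (B := B) (samp := samp) (X0 := X0) hcon hcost k).mono
      (pastσ_mono (Nat.le_succ k)) le_rfl)
  have h2 := (measurable_batch (B := B) (samp := samp) k).mono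
    (batchσ_le_pastσ_succ (X0 := X0) k) le_rfl
  have h3 := (measurable_batchMean hcost (B k)).comp (h2.prodMk h1)
  have e : err g p P ξ B samp X0 k = fun ω =>
      batchMean g (fun i (t : Fin (B k)) => samp k i t ω) (iter g p B samp X0 k ω).1
      - g.F P ξ (iter g p B samp X0 k ω).1 := funext (err_eq P ξ k)
  rw [e]
  exact h3.sub ((measurable_F hξ hcost).comp h1)

theorem ae_exists_tendsto_sum_inner_err {η ℓ β τ : ℝ} [IsProbabilityMeasure P]
    (hξ : Measurable ξ) (hcon : g.ConstraintAssumptions) (hcost : g.CostAssumptions P ξ)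
    (hs : StepAssumptions g p η ℓ β τ) (hsamp : IsSampling P ξ B samp X0)
    (hX0 : ∀ ω, (X0 ω).1 ∈ g.domain) (hB : ∀ k, B k ≠ 0)
    (herr : ∀ k, Integrable (fun ω => ‖err g p P ξ B samp X0 k ω‖ ^ 2) P)
    (hsum : Summable fun k => ∫ ω, ‖err g p P ξ B samp X0 k ω‖ ^ 2 ∂P)
    {v : Strat n} (hv : v ∈ g.domain) :
    ∀ᵐ ω ∂P, ∃ s, Tendsto (fun K => ∑ k ∈ Finset.range K, inner ℝ (err g p P ξ B samp X0 k ω)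
      (xTilde g p (g.F P ξ (iter g p B samp X0 k ω).1) (iter g p B samp X0 k ω) - v))
      atTop (𝓝 s) := by
  obtain ⟨R, hR⟩ := exists_norm_sub_le hcon
  have hxt : Measurable fun w : State n m => xTilde g p (g.F P ξ w.1) w - v :=
    ((continuous_xTilde hcon).measurable.comp
      (((measurable_F hξ hcost).comp measurable_fst).prodMk measurable_id)).sub_const v
  set d : ℕ → Ξ → ℝ := fun k ω => inner ℝ (err g p P ξ B samp X0 k ω)
    (xTilde g p (g.F P ξ (iter g p B samp X0 k ω).1) (iter g p B samp X0 k ω) - v) with hd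
  have hit := measurable_iter (p := p) (B := B) (samp := samp) (X0 := X0) hcon hcost
  have hdm : ∀ k, Measurable[pastσ B samp X0 (k + 1)] (d k) := fun k =>
    (measurable_err hξ hcon hcost k).inner
      (hxt.comp ((hit k).mono (pastσ_mono (Nat.le_succ k)) le_rfl))
  have hdm' : ∀ k, Measurable (d k) := fun k => (hdm k).mono (pastσ_le hsamp _) le_rfl
  have hle : ∀ k ω, d k ω ^ 2 ≤ R ^ 2 * ‖err g p P ξ B samp X0 k ω‖ ^ 2 := fun k ω => by
    rw [← mul_pow, ← sq_abs]
    refine pow_le_pow_left₀ (abs_nonneg _) ((abs_real_inner_le_norm _ _).trans ?_) 2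
    rw [mul_comm]
    exact mul_le_mul_of_nonneg_right (hR _ (xTilde_mem hcon _ _) _ hv) (norm_nonneg _)
  have hdi : ∀ k, Integrable (fun ω => d k ω ^ 2) P := fun k =>
    ((herr k).const_mul (R ^ 2)).mono' ((hdm' k).pow_const 2).aestronglyMeasurable
      (.of_forall fun ω => by
        rw [Real.norm_of_nonneg (sq_nonneg _)]
        exact hle k ω)
  refine ae_exists_tendsto_sum_of_orthogonal (pastFiltration hsamp) hdm
    (fun k => (memLp_two_iff_integrable_sq (hdm' k).aestronglyMeasurable).2 (hdi k))
    (fun k φ hφ hint => ?_) ?_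
  -- `H` separates the past, namely the iterate and the test function, from the fresh batch. With
  -- the past frozen, its integral vanishes by unbiasedness.
  · let H : (State n m × ℝ) × (Fin N → Fin (B k) → S) → ℝ := fun q =>
      q.1.2 * inner ℝ (batchMean g q.2 q.1.1.1 - g.F P ξ q.1.1.1)
        (xTilde g p (g.F P ξ q.1.1.1) q.1.1 - v)
    have hx : Measurable fun q : (State n m × ℝ) × (Fin N → Fin (B k) → S) => q.1.1.1 :=
      measurable_fst.comp (measurable_fst.comp measurable_fst)
    have hH : Measurable H :=
      (measurable_snd.comp measurable_fst).mul
        ((((measurable_batchMean hcost (B k)).comp (measurable_snd.prodMk hx)).sub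
          ((measurable_F hξ hcost).comp hx)).inner
          (hxt.comp (measurable_fst.comp measurable_fst)))
    have e : (fun ω => φ ω * d k ω) = fun ω => H ((iter g p B samp X0 k ω, φ ω),
        fun i (t : Fin (B k)) => samp k i t ω) := funext fun ω => by simp only [hd, err_eq, H]
    rw [e] at hint ⊢
    refine integral_eq_zero_of_indep (pastσ_le hsamp k) (batchσ_le hsamp k)
      (hsamp.indep_past k).symm ((hit k).prodMk hφ) (measurable_batch k) hH hint fun ω' => ?_
    simp only [H]
    rw [integral_const_mul, integral_inner_batchMean_sub_eq_zero hξ hcost (hB k)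
      (fun i t => hsamp.law k i t) (iter_mem hcon hs hX0 k ω'), mul_zero]
  · refine Summable.of_nonneg_of_le (fun k => integral_nonneg fun ω => sq_nonneg _) (fun k => ?_)
      (hsum.mul_left (R ^ 2))
    rw [← integral_const_mul]
    exact integral_mono (hdi k) ((herr k).const_mul _) (hle k)

end stochastic

end SGNEP
end

/-! ### The main theorem. -/

open SGNEP in
theorem theorem1 {N : ℕ} {n : Fin N → ℕ} {m : ℕ} {S Ξ : Type*} [MeasurableSpace S]
    [MeasurableSpace Ξ] (P : Measure Ξ) [IsProbabilityMeasure P] (ξ : Ξ → S) (hξ : Measurable ξ)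
    (g : Game N n m S) (hcon : g.ConstraintAssumptions) (hcost : g.CostAssumptions P ξ)
    (η ℓ : ℝ) (hF : g.PseudoGradientAssumptions P ξ η ℓ)
    (p : Params N m) (hb : ∑ i, p.b i = g.b)
    (G : SimpleGraph (Fin N)) (hG : DualGraph G p.W)
    (β τ : ℝ) (hstep : StepAssumptions g p η ℓ β τ)
    (B : ℕ → ℕ) (hB : ∃ c k₀ a : ℝ, 0 < c ∧ 0 < k₀ ∧ 0 < a ∧
      ∀ k : ℕ, c * ((k : ℝ) + k₀) ^ (a + 1) ≤ (B k : ℝ))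
    (samp : ℕ → Fin N → ℕ → Ξ → S) (X0 : Ξ → State n m)
    (hsamp : IsSampling P ξ B samp X0)
    (hX0 : ∀ ω, (X0 ω).1 ∈ g.domain ∧ ∀ i, (X0 ω).2.2 i ∈ orthant m)
    (q : ℕ) (hq : q = 1 ∨ q = 2) (C ς : ℝ)
    (herr : ∀ k, Integrable (fun ω => ‖err g p P ξ B samp X0 k ω‖ ^ q) P ∧
      ∀ᵐ ω ∂P, (P[fun ω => ‖err g p P ξ B samp X0 k ω‖ ^ q | pastσ B samp X0 k]) ω
        ≤ C * ς ^ 2 / (B k : ℝ)) :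
    ∃ xs : Strat n, g.IsVGNE P ξ xs ∧
      ∀ᵐ ω ∂P,
        Tendsto (fun k => (iter g p B samp X0 k ω).1) atTop (𝓝 xs) ∧
        ∃ (zs : Fin N → Vec m) (ls : Vec m),
          Tendsto (fun k => (iter g p B samp X0 k ω).2.1) atTop (𝓝 zs) ∧
          Tendsto (fun k => (iter g p B samp X0 k ω).2.2) atTop (𝓝 (fun _ => ls)) ∧
          g.IsKKT P ξ xs ls := by
  obtain ⟨c, k₀, a, hc, hk₀, ha, hBk⟩ := hB
  have hB0 : ∀ k, B k ≠ 0 := fun k h0 => by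
    have h := hBk k
    have : 0 < c * ((k : ℝ) + k₀) ^ (a + 1) := by positivity
    rw [h0, Nat.cast_zero] at h
    linarith
  have hsumInt : Summable fun k => ∫ ω, ‖err g p P ξ B samp X0 k ω‖ ^ q ∂P := by
    refine Summable.of_nonneg_of_le (fun k => integral_nonneg fun ω => by positivity) (fun k => ?_)
      ((summable_inv_of_rpow_le hc hk₀ ha hBk).mul_left (C * ς ^ 2))
    -- Integrating the conditional bound leaves a constant multiple of the inverse batch size.
    rw [← integral_condExp (pastσ_le hsamp k), ← div_eq_mul_inv]
    have h := integral_mono_ae integrable_condExp (integrable_const _) (herr k).2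
    simpa using h
  have hsumAe := ae_summable_of_summable_integral (fun k => (herr k).1)
    (fun k ω => by positivity) hsumInt
  obtain ⟨xs, hxs⟩ := exists_isSVISolution hcon hF
  obtain ⟨v, hv, rfl⟩ := exists_isZero hcon hb hG hxs
  have hM : ∀ᵐ ω ∂P, ∃ s, Tendsto (fun K => ∑ k ∈ Finset.range K,
      inner ℝ (err g p P ξ B samp X0 k ω) (xTilde g p (g.F P ξ (iter g p B samp X0 k ω).1)
        (iter g p B samp X0 k ω) - v.1)) atTop (𝓝 s) := by
    rcases hq with rfl | rfl
    · obtain ⟨R, hR⟩ := exists_norm_sub_le hcon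
      filter_upwards [hsumAe] with ω hω
      refine ⟨_, (Summable.of_norm_bounded (hω.mul_left R) fun k => ?_).hasSum.tendsto_sum_nat⟩
      rw [pow_one, mul_comm]
      exact (norm_inner_le_norm _ _).trans (mul_le_mul_of_nonneg_left
        (hR _ (xTilde_mem hcon _ _) _ hv.mem) (norm_nonneg _))
    · exact ae_exists_tendsto_sum_inner_err hξ hcon hcost hstep hsamp (fun ω => (hX0 ω).1) hB0
        (fun k => (herr k).1) hsumInt hv.mem
  refine ⟨v.1, isVGNE_of_isSVISolution hξ hcost hxs, ?_⟩
  filter_upwards [hsumAe, hM] with ω hω hMω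
  -- If `q = 1`, the summable norms are eventually at most 1 and so dominate their squares.
  have hsq : Summable fun k => ‖err g p P ξ B samp X0 k ω‖ ^ 2 := by
    rcases hq with rfl | rfl
    · simp only [pow_one] at hω
      refine Summable.of_norm_bounded_eventually_nat hω ?_
      filter_upwards [hω.tendsto_atTop_zero.eventually_le_const one_pos] with k hk
      rw [Real.norm_of_nonneg (sq_nonneg _), sq]
      exact mul_le_of_le_one_left (norm_nonneg _) hk
    · exact hω
  obtain ⟨u, hu, hlim⟩ := exists_tendsto_of_errors hcon hF hb hG hstep hv
    (w := fun k => iter g p B samp X0 k ω) (ε := fun k => err g p P ξ B samp X0 k ω)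
    (hX0 ω).1 (fun k => by simp only [iter, err, add_sub_cancel]) hsq hMω
  obtain ⟨i₀⟩ := hG.connected.nonempty
  obtain ⟨hconst, hkkt⟩ := hu.isKKT hG hb i₀
  have hfst := hu.fst_eq hF hG hb hv
  refine ⟨?_, u.2.1, u.2.2 i₀, ?_, ?_, hfst ▸ hkkt⟩
  · rw [← hfst]
    exact (continuous_fst.tendsto u).comp hlim
  · exact ((continuous_fst.comp continuous_snd).tendsto u).comp hlim
  · rw [← hconst]
    exact ((continuous_snd.comp continuous_snd).tendsto u).comp hlim
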